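/- **Setting.** There are $n\ge 1$ products $N=\{1,\dots,n\}$ with prices $r_i$, and $m$ customer types; a random customer is of type $j$ with probability $\alpha_j$. Type $j$ chooses from an offered assortment $X\subseteq N$ according to a multinomial logit (MNL) model $\phi_j$ with parameters $v_{j,i}\ge 0$ $(i\in N)$ and $v_{j,0}\ge 0$, i.e. picks $i\in X$ with probability $\phi_j(i,X)=v_{j,i}/(v_{j,0}+\sum_{e\in X}v_{j,e})$ (with $0/0=0$). Put $R_{\phi_j}(X)=\sum_{i\in X}r_i\,\phi_j(i,X)$. In joint customization and assortment optimization one chooses a selection $S\subseteq N$, subject to a constraint, so as to maximize $$F(S)=\sum_{j=1}^m\alpha_j\max_{X\subseteq S}R_{\phi_j}(X).$$ Let $\pi$ be any ordering of the products by descending price (ties broken arbitrarily), and write $f(C\mid A)=f(A\cup C)-f(A)$. **Theorem.** 1. *(Submodular order.)* $F(\emptyset)=0$, $F$ is monotone and subadditive, and $\pi$ is a (strong) submodular order for $F$: $F(C\mid A)\le F(C\mid B)$ whenever $B\subseteq A$ and every element of $C$ comes after every element of $A$ in $\pi$. So the problem with constraint $|S|\le k$ is an instance of cardinality-constrained submodular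 order maximization. In parts 2–4 the algorithms access $F$ only through value queries; all $O(\cdot)$ constants are absolute and do not depend on $m$. 2. *(Cardinality.)* Let $k\ge 1$, $\varepsilon\in(0,1)$. For $\tau\in\{(1+\varepsilon)^{i-1}\tfrac1k\max_{e\in N}F(\{e\}) : 1\le i\le \max(1,\lceil\log_{1+\varepsilon}k\rceil)\}$, parse the products in the order $\pi$, starting with $S_\tau=\emptyset$ and adding $e$ to $S_\tau$ whenever $|S_\tau|<k$ and $F(e\mid S_\tau)\ge\tau$; output the best $S_\tau$. This algorithm outputs $S$ with $|S|\le k$ and $F(S)\ge\frac{1-\varepsilon}{2}\max_{|T|\le k}F(T)$ (in particular it is a $(0.5-\varepsilon)$-approximation, for every $m$) using $O(\frac n\varepsilon\log(k+1))$ queries. 3. *(Budget.)* For weights $b_i\ge 0$, a budget $B>0$ and $\varepsilon\in(0,\frac12)$, the following algorithm outputs $S$ with $b(S)\le B$ and $F(S)\ge(\frac12-\varepsilon)\max_{b(T)\le B}F(T)$, using $O(\frac1\varepsilon n^{1+1/\varepsilon}\log(n+1))$ queries. For every $X\subseteq N$ with $b(X)\le B$, $|X|\le 1/\varepsilon$,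 let $N_X$ consist of $X$ and of all $e\notin X$ with $b_e\le\min_{i\in X}b_i$ (no condition if $X=\emptyset$) and $b_e<\varepsilon B$. For each $\tau=(1+\varepsilon)^{i-1}\frac1B\max_{e\in N_X}F(\{e\})$, $1\le i\le\lceil\log_{1+\varepsilon}|N_X|\rceil$, parse $N_X$ in the order $\pi$, starting with $S=\emptyset$ and stopping when $b(S)\ge B$: if $F(e\mid S)\ge\tau b_e$ and $b(S)+b_e\le B$, add $e$ to $S$; if $F(e\mid S)\ge\tau b_e$ and $b(S)+b_e>B$, remove elements of weight less than $\varepsilon B$ from $S$, one at a time, until $e$ fits or none is left, add $e$ if it fits, and stop. Output the best of all sets $X$ and all sets $S$ so obtained. 4. *(Matroid.)* For a matroid on $N$ of rank $d$ with family $\mathcal I$ of independent sets, the following algorithm outputs $S\in\mathcal I$ with $F(S)\ge\frac14\max_{T\in\mathcal I}F(T)$, using $O(n\max(d,1))$ value and independence queries. Start with $S=R=\emptyset$ and parse $N$ in the order $\pi$. If $S+j\in\mathcal I$, set $v_j=F(j\mid S\cup R)$ and add $j$ to $S$. Otherwise let $C$ be the circuit in $S+j$; if $C\ne\{j\}$,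 take $i\in C\setminus\{j\}$ with $v_i$ minimal and, if $F(j\mid S\cup R)>v_i$, set $v_j=v_i+F(j\mid S\cup R)$, replace $i$ by $j$ in $S$, and add $i$ to $R$. Output the final $S$. 5. *(Value oracle.)* Given $\pi$, the value $F(S)$ can be computed for every $S$ with $O(mn)$ elementary operations: for each type, evaluate the revenues of all initial segments of $S$ in the order $\pi$ and take the largest of them and $0$. -/

import Mathlib

open scoped BigOperators

noncomputable section

namespace SubmodularOrder

/-! ### Set functions on the ground set `Fin n` and submodular orders

An order on the `n` elements is a permutation `π`: the element at position `p` is `π p`, and the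
position of the element `i` is `π.symm i`. -/

/-- Marginal value `f(X | S) = f(X ∪ S) - f(S)`. -/
def marginal {n : ℕ} (f : Finset (Fin n) → ℝ) (X S : Finset (Fin n)) : ℝ :=
  f (X ∪ S) - f S

/-- Every element of `C` comes after every element of `A` in the order `π`. -/
def RightOf {n : ℕ} (π : Equiv.Perm (Fin n)) (A C : Finset (Fin n)) : Prop :=
  ∀ a ∈ A, ∀ c ∈ C, π.symm a < π.symm c

/-- `π` is a (strong) submodular order of `f`. -/
def IsSubmodularOrder {n : ℕ} (π : Equiv.Perm (Fin n)) (f : Finset (Fin n) → ℝ) : Prop :=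
  ∀ A B C : Finset (Fin n), B ⊆ A → RightOf π A C → marginal f C A ≤ marginal f C B

/-- The objectives of submodular order maximization: normalized, monotone, subadditive set
functions with submodular order `π`. -/
structure IsSubmodularOrderFunction {n : ℕ} (π : Equiv.Perm (Fin n))
    (f : Finset (Fin n) → ℝ) : Prop where
  map_empty : f ∅ = 0
  monotone : Monotone f
  subadditive : ∀ A B : Finset (Fin n), f (A ∪ B) ≤ f A + f B
  submodularOrder : IsSubmodularOrder π f

/-- `S` is feasible and its value is at least `c` times that of every feasible set. -/
def IsApproxMax {n : ℕ} (c : ℝ) (feasible : Finset (Fin n) → Prop) (f : Finset (Fin n) → ℝ)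
    (S : Finset (Fin n)) : Prop :=
  feasible S ∧ ∀ T : Finset (Fin n), feasible T → c * f T ≤ f S

/-- Total weight `b(S)`. -/
def weight {n : ℕ} (b : Fin n → ℝ) (S : Finset (Fin n)) : ℝ := ∑ i ∈ S, b i

/-! ### Multinomial logit choice and the joint customization objective -/

/-- A multinomial logit choice model on `n` products; `v₀` belongs to the outside option. -/
structure MNL (n : ℕ) where
  v : Fin n → ℝ
  v₀ : ℝ
  v_nonneg : ∀ i, 0 ≤ v i
  v₀_nonneg : 0 ≤ v₀

/-- Probability that product `i ∈ S` is chosen from the assortment `S`. (If `v₀` and all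
parameters of `S` vanish, the quotient is `0 / 0 = 0`: nothing is bought.) -/
def MNL.choiceProb {n : ℕ} (φ : MNL n) (i : Fin n) (S : Finset (Fin n)) : ℝ :=
  φ.v i / (φ.v₀ + ∑ e ∈ S, φ.v e)

/-- Expected revenue `R_φ(S)` of the assortment `S` at prices `r`. -/
def MNL.revenue {n : ℕ} (φ : MNL n) (r : Fin n → ℝ) (S : Finset (Fin n)) : ℝ :=
  ∑ i ∈ S, r i * φ.choiceProb i S

/-- `f_φ(S)`, the maximum of `R_φ(X)` over all assortments `X ⊆ S`. -/
def MNL.optRevenue {n : ℕ} (φ : MNL n) (r : Fin n → ℝ) (S : Finset (Fin n)) : ℝ :=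
  S.powerset.sup' ⟨∅, Finset.empty_mem_powerset S⟩ (φ.revenue r)

/-- A population of `m` customer types: a random customer is of type `j` with probability `α j`
and then chooses according to the multinomial logit model `φ j`. -/
structure MNLMixture (n m : ℕ) where
  α : Fin m → ℝ
  φ : Fin m → MNL n
  α_nonneg : ∀ j, 0 ≤ α j
  α_sum : ∑ j, α j = 1

/-- Expected revenue from the selection `S`, when each type is offered its own best assortment
`X ⊆ S`. -/
def MNLMixture.objective {n m : ℕ} (P : MNLMixture n m) (r : Fin n → ℝ)
    (S : Finset (Fin n)) : ℝ :=
  ∑ j, P.α j * (P.φ j).optRevenue r S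

/-! ### Computations with a cost counter -/

/-- The result of a computation together with the number of unit-cost operations charged. -/
structure Counted (α : Type) where
  val : α
  cost : ℕ

namespace Counted

theorem eq_of {α : Type} {x y : Counted α} (h₁ : x.val = y.val) (h₂ : x.cost = y.cost) :
    x = y := by
  cases x; cases y; cases h₁; cases h₂; rfl

instance : Monad Counted where
  pure a := ⟨a, 0⟩
  bind x g := ⟨(g x.val).val, x.cost + (g x.val).cost⟩

instance : LawfulMonad Counted := LawfulMonad.mk'
  (id_map := fun x => eq_of rfl (Nat.add_zero x.cost))
  (pure_bind := fun x g => eq_of rfl (Nat.zero_add (g x).cost))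
  (bind_assoc := fun x g h => eq_of rfl
    (Nat.add_assoc x.cost (g x.val).cost (h (g x.val).val).cost))

/-- Charge `c` units. -/
def charge (c : ℕ) : Counted Unit := ⟨(), c⟩

end Counted

/-- The value oracle of `f`: each call is charged one unit. -/
def valueOracle {n : ℕ} (f : Finset (Fin n) → ℝ) : Finset (Fin n) → Counted ℝ :=
  fun S => ⟨f S, 1⟩

/-! ### Common subroutines

Every algorithm accesses the objective only through calls to an oracle `q`. -/

/-- All elements, listed in the order `π`. -/
def orderedList {n : ℕ} (π : Equiv.Perm (Fin n)) : List (Fin n) := (List.finRange n).map π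

/-- `f(i | S)`, by two oracle calls. -/
def askMarginal {n : ℕ} (q : Finset (Fin n) → Counted ℝ) (i : Fin n) (S : Finset (Fin n)) :
    Counted ℝ := do
  let x ← q (insert i S)
  let y ← q S
  pure (x - y)

/-- The largest value `f({e})` over the elements of a list (`0` for the empty list). -/
def maxSingleton {n : ℕ} (q : Finset (Fin n) → Counted ℝ) (L : List (Fin n)) : Counted ℝ :=
  L.foldlM (fun x e => do
    let y ← q {e}
    pure (max x y)) 0

/-- A set of largest value in a list of sets (`∅` for the empty list). -/
def bestOf {n : ℕ} (q : Finset (Fin n) → Counted ℝ) :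
    List (Finset (Fin n)) → Counted (Finset (Fin n))
  | [] => pure ∅
  | S :: L => do
    let x ← q S
    let best ← L.foldlM (fun (s : Finset (Fin n) × ℝ) T => do
      let y ← q T
      pure (if s.2 < y then (T, y) else s)) (S, x)
    pure best.1

/-! ### Cardinality constraint -/

/-- Parse the elements in the order `π`, adding each one whose marginal value is at least `τ`, as
long as fewer than `k` elements are chosen. -/
def thresholdAdd {n : ℕ} (q : Finset (Fin n) → Counted ℝ) (π : Equiv.Perm (Fin n)) (k : ℕ)
    (τ : ℝ) : Counted (Finset (Fin n)) :=
  (orderedList π).foldlM (fun S i =>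
    if S.card < k then do
      let d ← askMarginal q i S
      pure (if τ ≤ d then insert i S else S)
    else pure S) ∅

/-- Number of thresholds `(1 + ε) ^ i` that are tried: `⌈log_{1+ε} N⌉`. -/
def gridSize (ε : ℝ) (N : ℕ) : ℕ := ⌈Real.logb (1 + ε) N⌉₊

/-- The threshold algorithm for the constraint `|S| ≤ k`. At least one threshold is tried (the
maximum only matters for `k = 1`). -/
def cardinalityAlg {n : ℕ} (q : Finset (Fin n) → Counted ℝ) (π : Equiv.Perm (Fin n)) (k : ℕ)
    (ε : ℝ) : Counted (Finset (Fin n)) := do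
  let M ← maxSingleton q (orderedList π)
  let sets ← (List.range (max 1 (gridSize ε k))).mapM
    fun i => thresholdAdd q π k ((1 + ε) ^ i * (M / k))
  bestOf q sets

/-! ### Budget constraint -/

open Classical in
/-- Make room for `j`: while `j` does not fit, remove from `S` an element of weight less than
`ε * B`. Afterwards add `j` if it fits. -/
def finalAdd {n : ℕ} (π : Equiv.Perm (Fin n)) (b : Fin n → ℝ) (B ε : ℝ) (S : Finset (Fin n))
    (j : Fin n) : Finset (Fin n) :=
  let T := (orderedList π).foldl (fun T i =>
    if i ∈ T ∧ b i < ε * B ∧ B < b j + weight b T then T.erase i else T) S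
  if b j + weight b T ≤ B then insert j T else T

open Classical in
/-- The inner loop over the elements `L`: add each element whose marginal value is at least `τ`
per unit of weight, while the weight is below `B`; at the first such element that does not fit, call
`finalAdd` and stop (the flag in the state records this). -/
def budgetThresholdAdd {n : ℕ} (q : Finset (Fin n) → Counted ℝ) (π : Equiv.Perm (Fin n))
    (b : Fin n → ℝ) (B ε : ℝ) (L : List (Fin n)) (τ : ℝ) : Counted (Finset (Fin n)) := do
  let s ← L.foldlM (fun (s : Finset (Fin n) × Bool) j =>
    if s.2 = false ∧ weight b s.1 < B then do
      let d ← askMarginal q j s.1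
      pure (if τ * b j ≤ d then
          if b j + weight b s.1 ≤ B then (insert j s.1, false)
          else (finalAdd π b B ε s.1 j, true)
        else s)
    else pure s) (∅, false)
  pure s.1

open Classical in
/-- The elements that remain when `X` is the guess for the heaviest elements of an optimal set:
those of `X`, and all others that are not heavier than any element of `X` and have weight less than
`ε * B`. -/
def filteredList {n : ℕ} (π : Equiv.Perm (Fin n)) (b : Fin n → ℝ) (B ε : ℝ)
    (X : Finset (Fin n)) : List (Fin n) :=
  (orderedList π).filter (fun e => e ∈ X ∨ ((∀ i ∈ X, b e ≤ b i) ∧ b e < ε * B))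

open Classical in
/-- The partial enumeration algorithm for the constraint `b(S) ≤ B`. -/
def budgetAlg {n : ℕ} (q : Finset (Fin n) → Counted ℝ) (π : Equiv.Perm (Fin n))
    (b : Fin n → ℝ) (B ε : ℝ) : Counted (Finset (Fin n)) := do
  let guesses : List (Finset (Fin n)) :=
    (Finset.univ.filter fun X : Finset (Fin n) => weight b X ≤ B ∧ (X.card : ℝ) ≤ 1 / ε).toList
  let candidates ← guesses.mapM fun X => do
    let L := filteredList π b B ε X
    let M ← maxSingleton q L
    let sets ← (List.range (gridSize ε L.length)).mapM
      fun i => budgetThresholdAdd q π b B ε L ((1 + ε) ^ i * (M / B))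
    bestOf q (X :: sets)
  bestOf q candidates

/-! ### Matroid constraint -/

/-- The current independent set `S`, the set `R` of elements swapped out so far, and the values
`v`. -/
structure SwapState (n : ℕ) where
  S : Finset (Fin n)
  R : Finset (Fin n)
  v : Fin n → ℝ

open Classical in
/-- Parsing the element `j`. If `S + j` is dependent, the elements `i ∈ S` with `S + j - i`
independent are the elements other than `j` of the unique circuit in `S + j`; one of smallest value
is swapped for `j` if the marginal value of `j` exceeds its value. Besides the oracle calls, one unit
is charged for each independence test. -/
def swapStep {n : ℕ} (q : Finset (Fin n) → Counted ℝ) (π : Equiv.Perm (Fin n))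
    (M : Matroid (Fin n)) (s : SwapState n) (j : Fin n) : Counted (SwapState n) := do
  Counted.charge 1
  if M.Indep (insert j s.S : Finset (Fin n)) then do
    let d ← askMarginal q j (s.S ∪ s.R)
    pure ⟨insert j s.S, s.R, Function.update s.v j d⟩
  else do
    Counted.charge s.S.card
    match ((orderedList π).filter (fun i =>
        i ∈ s.S ∧ M.Indep ((insert j s.S).erase i : Finset (Fin n)))).argmin s.v with
    | none => pure s
    | some i => do
      let d ← askMarginal q j (s.S ∪ s.R)
      pure (if s.v i < d then
          ⟨(insert j s.S).erase i, insert i s.R, Function.update s.v j (s.v i + d)⟩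
        else s)

/-- The directed local search along `π` for the constraint that `S` is independent in `M`. -/
def matroidAlg {n : ℕ} (q : Finset (Fin n) → Counted ℝ) (π : Equiv.Perm (Fin n))
    (M : Matroid (Fin n)) : Counted (Finset (Fin n)) := do
  let s ← (orderedList π).foldlM (swapStep q π M) ⟨∅, ∅, fun _ => 0⟩
  pure s.S

/-! ### Implementing the value oracle -/

/-- Evaluates `f_φ(S)` by parsing the products in the order `π` (descending prices) and recording
the best revenue among the initial segments of `S`. For each product six operations are charged: the
test `i ∈ S`, a product, two sums, a quotient and a comparison. -/
def evalOptRevenue {n : ℕ} (φ : MNL n) (r : Fin n → ℝ) (π : Equiv.Perm (Fin n))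
    (S : Finset (Fin n)) : Counted ℝ := do
  let s ← (orderedList π).foldlM (fun (s : ℝ × ℝ × ℝ) i => do
    Counted.charge 6
    pure (if i ∈ S then
        let num := s.1 + r i * φ.v i
        let den := s.2.1 + φ.v i
        (num, den, max s.2.2 (num / den))
      else s)) (0, φ.v₀, 0)
  pure s.2.2

/-- Evaluates the joint customization objective; for each type a product and a sum are charged in
addition to the cost of `evalOptRevenue`. -/
def evalObjective {n m : ℕ} (P : MNLMixture n m) (r : Fin n → ℝ) (π : Equiv.Perm (Fin n))
    (S : Finset (Fin n)) : Counted ℝ :=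
  (List.finRange m).foldlM (fun x j => do
    let y ← evalOptRevenue (P.φ j) r π S
    Counted.charge 2
    pure (x + P.α j * y)) 0

end SubmodularOrder

end

/-! For one type, write f for `optRevenue` and let l be an optimal revenue. An assortment Z of
positive denominator earns at least l exactly when the sum of v_i (r_i - l) over Z is at least l v₀,
so keeping all products priced at least l is optimal (`MNL.optRevenue_eq_revenue_filter`). If
cheaper products C strictly raise the value of A, some product of C is priced at least l, hence so
is all of A. Then A and every B ⊆ A are offered in full, and the comparison of marginals becomes an
inequality between fractions (`MNL.isSubmodularOrder_optRevenue`). Nonnegative mixtures inherit this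
property, so no guarantee or query count depends on the number of types.

The algorithms are analysed through `gain`, the marginal value of i over its predecessors in A.
Gains sum to f(A) and decrease as A grows. Two consequences replace submodularity: a subset S of A
keeps at least its gains in A (`sum_gain_le`), and f(T) is at most f(S) plus the gains in S of the
elements of T \ S (`le_add_sum_gain`). Elements parsed later do not alter a gain, so a decision made
during a pass describes the final set.

With a threshold, a pass either nearly fills the constraint, giving value about τ times the
capacity, or rejects only small gains, giving OPT ≤ f(S) + τ times the capacity. A geometric grid
contains a τ for which both are about OPT/2. For budgets, guessing the heaviest elements makes the
others light, so making room for the last element costs at most an ε fraction.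

For matroids (`SwapInvariant`), the values on S sum to f(S ∪ R), each is at most twice a gain, and
each rejected e is spanned by elements of S of value at least the gain of e. Counting ranks above
each threshold bounds the gains of any independent T by f(S ∪ R), so f(T) ≤ 2 f(S ∪ R) ≤ 4 f(S). -/

namespace SubmodularOrder

/-! ### Values and costs of counted computations -/

namespace Counted

variable {α β : Type}

@[simp] theorem pure_val (a : α) : (pure a : Counted α).val = a := rfl

@[simp] theorem pure_cost (a : α) : (pure a : Counted α).cost = 0 := rfl

@[simp] theorem bind_val (x : Counted α) (g : α → Counted β) :
    (x >>= g).val = (g x.val).val := rfl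

@[simp] theorem bind_cost (x : Counted α) (g : α → Counted β) :
    (x >>= g).cost = x.cost + (g x.val).cost := rfl

@[simp] theorem map_val (g : α → β) (x : Counted α) : (g <$> x).val = g x.val := rfl

@[simp] theorem map_cost (g : α → β) (x : Counted α) : (g <$> x).cost = x.cost := rfl

@[simp] theorem charge_cost (c : ℕ) : (charge c).cost = c := rfl

theorem foldlM_val (g : β → α → Counted β) (L : List α) (s : β) :
    (L.foldlM g s).val = L.foldl (fun s a => (g s a).val) s := by
  induction L generalizing s with
  | nil => rfl
  | cons a L ih => simp [List.foldlM_cons, ih]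

/-- The invariant `p` admits step costs that are bounded only on reachable states; the matroid
algorithm needs this, since the cost of a step depends on the size of an independent set. -/
theorem foldlM_cost_le {g : β → α → Counted β} {c : ℕ} (p : β → Prop)
    (hp : ∀ s a, p s → p (g s a).val) (hc : ∀ s a, p s → (g s a).cost ≤ c) (L : List α) {s : β}
    (hs : p s) : (L.foldlM g s).cost ≤ L.length * c := by
  induction L generalizing s with
  | nil => simp
  | cons a L ih =>
    have h₁ := hc s a hs
    have h₂ := ih (hp s a hs)
    simp only [List.foldlM_cons, bind_cost, List.length_cons, Nat.add_mul, one_mul]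
    omega

theorem mapM_val (g : α → Counted β) (L : List α) :
    (L.mapM g).val = L.map fun a => (g a).val := by
  induction L with
  | nil => simp
  | cons a L ih => simp [List.mapM_cons, ih]

theorem mapM_cost_le {g : α → Counted β} {c : ℕ} (hc : ∀ a, (g a).cost ≤ c) (L : List α) :
    (L.mapM g).cost ≤ L.length * c := by
  induction L with
  | nil => simp
  | cons a L ih =>
    have h₁ := hc a
    simp only [List.mapM_cons, bind_cost, pure_cost, List.length_cons, Nat.add_mul, one_mul]
    omega

end Counted

/-! ### Submodular orders -/

section SetFunction

variable {n : ℕ} {π : Equiv.Perm (Fin n)} {f : Finset (Fin n) → ℝ}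

/-- The elements of `A` before `i` in the order `π`. -/
def before (π : Equiv.Perm (Fin n)) (A : Finset (Fin n)) (i : Fin n) : Finset (Fin n) :=
  A.filter fun a => π.symm a < π.symm i

/-- Marginal value of `i` with respect to the part of `A` before `i`. -/
def gain (π : Equiv.Perm (Fin n)) (f : Finset (Fin n) → ℝ) (A : Finset (Fin n)) (i : Fin n) : ℝ :=
  f (insert i (before π A i)) - f (before π A i)

theorem before_eq_self {A : Finset (Fin n)} {i : Fin n} (h : ∀ a ∈ A, π.symm a < π.symm i) :
    before π A i = A := Finset.filter_true_of_mem h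

theorem before_insert_of_le {A : Finset (Fin n)} {i j : Fin n} (h : π.symm i ≤ π.symm j) :
    before π (insert j A) i = before π A i := by
  rw [before, Finset.filter_insert, if_neg (not_lt.mpr h), before]

theorem gain_eq {A : Finset (Fin n)} {i : Fin n} (h : ∀ a ∈ A, π.symm a < π.symm i) :
    gain π f A i = f (insert i A) - f A := by
  rw [gain, before_eq_self h]

theorem gain_insert_of_le {A : Finset (Fin n)} {i j : Fin n} (h : π.symm i ≤ π.symm j) :
    gain π f (insert j A) i = gain π f A i := by
  rw [gain, before_insert_of_le h, gain]

theorem gain_insert_self {A : Finset (Fin n)} {i : Fin n} (h : ∀ a ∈ A, π.symm a < π.symm i) :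
    gain π f (insert i A) i = f (insert i A) - f A := by
  rw [gain_insert_of_le le_rfl, gain_eq h]

/-- Telescoping: the elements of `A` are added in the order `π`. -/
theorem sum_gain (h0 : f ∅ = 0) (A : Finset (Fin n)) : ∑ i ∈ A, gain π f A i = f A := by
  induction A using Finset.induction_on_max_value π.symm with
  | empty => simp [h0]
  | insert a s ha hs ih =>
    have hlt : ∀ x ∈ s, π.symm x < π.symm a := fun x hx =>
      lt_of_le_of_ne (hs x hx) fun h => ha (π.symm.injective h ▸ hx)
    rw [Finset.sum_insert ha, gain_insert_self hlt,
      Finset.sum_congr rfl fun x hx => gain_insert_of_le (f := f) (A := s) (hs x hx), ih]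
    ring

namespace IsSubmodularOrderFunction

variable (hf : IsSubmodularOrderFunction π f)
include hf

theorem nonneg (A : Finset (Fin n)) : 0 ≤ f A :=
  hf.map_empty ▸ hf.monotone (Finset.empty_subset A)

theorem gain_nonneg (A : Finset (Fin n)) (i : Fin n) : 0 ≤ gain π f A i :=
  sub_nonneg.mpr (hf.monotone (Finset.subset_insert _ _))

/-- Only predecessors of `i` enter a gain, so the submodular order property applies with C = {i}. -/
theorem gain_anti {A B : Finset (Fin n)} (h : B ⊆ A) (i : Fin n) :
    gain π f A i ≤ gain π f B i := by
  have := hf.submodularOrder (before π A i) (before π B i) {i} (Finset.filter_subset_filter _ h)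
    (by
      intro a ha c hc
      rw [Finset.mem_singleton.mp hc]
      exact (Finset.mem_filter.mp ha).2)
  simpa only [marginal, gain, ← Finset.insert_eq] using this

/-- Used when elements have been discarded: the survivors retain the gains they had in the larger
set. -/
theorem sum_gain_le {A S : Finset (Fin n)} (h : S ⊆ A) : ∑ i ∈ S, gain π f A i ≤ f S := by
  rw [← sum_gain (π := π) hf.map_empty S]
  exact Finset.sum_le_sum fun i _ => hf.gain_anti h i

/-- Expand f(S ∪ T) into gains and shrink the reference set to `S`. This bounds an optimum `T` by
the gains of the elements that a pass did not select. -/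
theorem le_add_sum_gain (S T : Finset (Fin n)) :
    f T ≤ f S + ∑ i ∈ T \ S, gain π f S i := by
  calc f T ≤ f (S ∪ T) := hf.monotone Finset.subset_union_right
    _ = ∑ i ∈ S ∪ T, gain π f (S ∪ T) i := (sum_gain hf.map_empty _).symm
    _ ≤ ∑ i ∈ S ∪ T, gain π f S i :=
      Finset.sum_le_sum fun i _ => hf.gain_anti Finset.subset_union_left i
    _ = f S + ∑ i ∈ T \ S, gain π f S i := by
      rw [← Finset.union_sdiff_self_eq_union, Finset.sum_union Finset.disjoint_sdiff,
        sum_gain hf.map_empty]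

theorem le_card_mul {M : ℝ} {T : Finset (Fin n)} (hM : ∀ e ∈ T, f {e} ≤ M) :
    f T ≤ T.card * M := by
  induction T using Finset.induction_on with
  | empty => simp [hf.map_empty]
  | insert a s ha ih =>
    have h₁ := hf.subadditive {a} s
    have h₂ := ih fun e he => hM e (Finset.mem_insert_of_mem he)
    have h₃ := hM a (Finset.mem_insert_self a s)
    rw [← Finset.insert_eq] at h₁
    rw [Finset.card_insert_of_notMem ha]
    push_cast
    linarith

end IsSubmodularOrderFunction

/-! ### Parsing in the order `π` -/

theorem pairwise_orderedList (π : Equiv.Perm (Fin n)) :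
    (orderedList π).Pairwise fun a b => π.symm a < π.symm b := by
  rw [orderedList, List.pairwise_map]
  simpa using List.pairwise_lt_finRange n

@[simp] theorem mem_orderedList (π : Equiv.Perm (Fin n)) (i : Fin n) : i ∈ orderedList π := by
  simp only [orderedList, List.mem_map, List.mem_finRange, true_and]
  exact ⟨π.symm i, by simp⟩

@[simp] theorem length_orderedList (π : Equiv.Perm (Fin n)) : (orderedList π).length = n := by
  simp [orderedList]

@[simp] theorem toFinset_orderedList (π : Equiv.Perm (Fin n)) :
    (orderedList π).toFinset = Finset.univ := by
  ext; simp

/-- Invariants of a pass through a list that is sorted by `π`: `P D s` says that the state is `s`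
once the elements of `D` have been parsed. -/
theorem foldl_induction {β : Type} {g : β → Fin n → β} {L : List (Fin n)}
    (hL : L.Pairwise fun a b => π.symm a < π.symm b) (P : Finset (Fin n) → β → Prop) {s : β}
    (h0 : P ∅ s)
    (hstep : ∀ D s j, j ∈ L → (∀ a ∈ D, π.symm a < π.symm j) → P D s → P (insert j D) (g s j)) :
    P L.toFinset (L.foldl g s) := by
  induction L using List.reverseRecOn with
  | nil => simpa
  | append_singleton L j ih =>
    rw [List.pairwise_append] at hL
    rw [List.foldl_append, List.toFinset_append]
    have h := hstep L.toFinset (L.foldl g s) j (by simp)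
      (fun a ha => hL.2.2 a (List.mem_toFinset.mp ha) j (by simp))
      (ih hL.1 fun D s j hj => hstep D s j (by simp [hj]))
    rwa [Finset.insert_eq, Finset.union_comm] at h

/-! ### Subroutines -/

@[simp] theorem valueOracle_val (S : Finset (Fin n)) : (valueOracle f S).val = f S := rfl

@[simp] theorem valueOracle_cost (S : Finset (Fin n)) : (valueOracle f S).cost = 1 := rfl

@[simp] theorem askMarginal_val (i : Fin n) (S : Finset (Fin n)) :
    (askMarginal (valueOracle f) i S).val = f (insert i S) - f S := rfl

@[simp] theorem askMarginal_cost (i : Fin n) (S : Finset (Fin n)) :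
    (askMarginal (valueOracle f) i S).cost = 2 := rfl

theorem maxSingleton_cost_le (L : List (Fin n)) :
    (maxSingleton (valueOracle f) L).cost ≤ L.length := by
  have := Counted.foldlM_cost_le (g := fun (x : ℝ) e => do
    let y ← valueOracle f {e}
    pure (max x y)) (c := 1) (fun _ => True) (fun _ _ _ => trivial) (by simp) L (s := 0) trivial
  simpa [maxSingleton] using this

theorem maxSingleton_spec (f : Finset (Fin n) → ℝ) (L : List (Fin n)) :
    0 ≤ (maxSingleton (valueOracle f) L).val ∧
      (∀ e ∈ L, f {e} ≤ (maxSingleton (valueOracle f) L).val) ∧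
      ((maxSingleton (valueOracle f) L).val = 0 ∨
        ∃ e ∈ L, f {e} = (maxSingleton (valueOracle f) L).val) := by
  rw [maxSingleton, Counted.foldlM_val]
  induction L using List.reverseRecOn with
  | nil => simp
  | append_singleton L j ih =>
    obtain ⟨h₁, h₂, h₃⟩ := ih
    simp only [List.foldl_append, List.foldl_cons, List.foldl_nil, Counted.bind_val,
      Counted.pure_val, valueOracle_val, List.mem_append, List.mem_singleton] at h₁ h₂ h₃ ⊢
    refine ⟨le_max_of_le_left h₁, ?_, ?_⟩
    · rintro e (he | rfl)
      · exact le_max_of_le_left (h₂ e he)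
      · exact le_max_right _ _
    · rcases max_choice (List.foldl (fun (s : ℝ) a => max s (f {a})) 0 L) (f {j}) with h | h
      · rw [h]
        rcases h₃ with h₃ | ⟨e, he, h₃⟩
        · exact .inl h₃
        · exact .inr ⟨e, .inl he, h₃⟩
      · rw [h]
        exact .inr ⟨j, .inr rfl, rfl⟩

theorem bestOf_cost_le (L : List (Finset (Fin n))) :
    (bestOf (valueOracle f) L).cost ≤ L.length := by
  cases L with
  | nil => simp [bestOf]
  | cons S L =>
    have := Counted.foldlM_cost_le (g := fun (s : Finset (Fin n) × ℝ) T => do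
      let y ← valueOracle f T
      pure (if s.2 < y then (T, y) else s)) (c := 1) (fun _ => True) (fun _ _ _ => trivial)
      (by simp) L (s := (S, f S)) trivial
    simp only [bestOf, Counted.bind_cost, Counted.pure_cost, valueOracle_cost, valueOracle_val,
      List.length_cons]
    omega

theorem bestOf_foldl_spec (f : Finset (Fin n) → ℝ) (L : List (Finset (Fin n)))
    (S : Finset (Fin n)) :
    let s := L.foldl (fun (s : Finset (Fin n) × ℝ) T => if s.2 < f T then (T, f T) else s) (S, f S)
    s.2 = f s.1 ∧ (s.1 = S ∨ s.1 ∈ L) ∧ f S ≤ s.2 ∧ ∀ T ∈ L, f T ≤ s.2 := by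
  induction L using List.reverseRecOn with
  | nil => simp
  | append_singleton L T ih =>
    obtain ⟨h₁, h₂, h₃, h₄⟩ := ih
    simp only [List.foldl_append, List.foldl_cons, List.foldl_nil, List.mem_append,
      List.mem_singleton]
    split_ifs with h
    · refine ⟨rfl, by simp, h₃.trans h.le, ?_⟩
      rintro U (hU | rfl)
      · exact (h₄ U hU).trans h.le
      · exact le_rfl
    · refine ⟨h₁, by tauto, h₃, ?_⟩
      rintro U (hU | rfl)
      · exact h₄ U hU
      · exact not_lt.mp h

theorem bestOf_spec (f : Finset (Fin n) → ℝ) {L : List (Finset (Fin n))} (hL : L ≠ []) :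
    (bestOf (valueOracle f) L).val ∈ L ∧
      ∀ T ∈ L, f T ≤ f (bestOf (valueOracle f) L).val := by
  cases L with
  | nil => exact absurd rfl hL
  | cons S L =>
    obtain ⟨h₁, h₂, h₃, h₄⟩ := bestOf_foldl_spec f L S
    have hval : (bestOf (valueOracle f) (S :: L)).val = (L.foldl (fun (s : Finset (Fin n) × ℝ) T =>
        if s.2 < f T then (T, f T) else s) (S, f S)).1 := by
      simp only [bestOf, Counted.bind_val, Counted.pure_val, Counted.foldlM_val]
      rfl
    rw [hval, ← h₁, List.mem_cons]
    refine ⟨h₂, fun T hT => ?_⟩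
    rcases List.mem_cons.mp hT with rfl | hT
    · exact h₃
    · exact h₄ T hT

end SetFunction

/-! ### Assortment optimization under the multinomial logit model -/

namespace MNL

variable {n : ℕ} (φ : MNL n) (r : Fin n → ℝ)

/-- Total preference weight of the assortment `X` together with the outside option. -/
def den (X : Finset (Fin n)) : ℝ := φ.v₀ + ∑ e ∈ X, φ.v e

theorem den_nonneg (X : Finset (Fin n)) : 0 ≤ φ.den X :=
  add_nonneg φ.v₀_nonneg (Finset.sum_nonneg fun i _ => φ.v_nonneg i)

theorem den_mono {X Y : Finset (Fin n)} (h : X ⊆ Y) : φ.den X ≤ φ.den Y :=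
  add_le_add_right (Finset.sum_le_sum_of_subset_of_nonneg h fun i _ _ => φ.v_nonneg i) _

theorem den_union {X Y : Finset (Fin n)} (h : Disjoint X Y) :
    φ.den (X ∪ Y) = φ.den X + ∑ e ∈ Y, φ.v e := by
  rw [den, den, Finset.sum_union h, add_assoc]

theorem v_le_den {X : Finset (Fin n)} {i : Fin n} (hi : i ∈ X) : φ.v i ≤ φ.den X :=
  (Finset.single_le_sum (fun i _ => φ.v_nonneg i) hi).trans (le_add_of_nonneg_left φ.v₀_nonneg)

theorem revenue_eq (X : Finset (Fin n)) :
    φ.revenue r X = (∑ i ∈ X, r i * φ.v i) / φ.den X := by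
  simp only [revenue, choiceProb, den, Finset.sum_div, mul_div_assoc]

theorem revenue_empty : φ.revenue r ∅ = 0 := by simp [revenue]

theorem revenue_mul_den (X : Finset (Fin n)) :
    φ.revenue r X * φ.den X = ∑ i ∈ X, r i * φ.v i := by
  rw [revenue_eq]
  by_cases h : φ.den X = 0
  · rw [h, mul_zero, Finset.sum_eq_zero]
    intro i hi
    rw [le_antisymm (h ▸ φ.v_le_den hi) (φ.v_nonneg i), mul_zero]
  · exact div_mul_cancel₀ _ h

theorem revenue_eq_zero {X : Finset (Fin n)} (h : φ.den X = 0) : φ.revenue r X = 0 := by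
  rw [revenue_eq, h, div_zero]

theorem choiceProb_nonneg (i : Fin n) (X : Finset (Fin n)) : 0 ≤ φ.choiceProb i X :=
  div_nonneg (φ.v_nonneg i) (φ.den_nonneg X)

theorem choiceProb_anti {X Y : Finset (Fin n)} (h : X ⊆ Y) {i : Fin n} (hi : i ∈ X) :
    φ.choiceProb i Y ≤ φ.choiceProb i X := by
  change φ.v i / φ.den Y ≤ φ.v i / φ.den X
  rcases (φ.den_nonneg X).eq_or_lt with h0 | h0
  · rw [le_antisymm (h0 ▸ φ.v_le_den hi) (φ.v_nonneg i), zero_div, zero_div]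
  · exact div_le_div_of_nonneg_left (φ.v_nonneg i) h0 (φ.den_mono h)

theorem revenue_le_optRevenue {X S : Finset (Fin n)} (h : X ⊆ S) :
    φ.revenue r X ≤ φ.optRevenue r S :=
  Finset.le_sup' (φ.revenue r) (Finset.mem_powerset.mpr h)

theorem exists_optRevenue_eq (S : Finset (Fin n)) :
    ∃ X ⊆ S, φ.optRevenue r S = φ.revenue r X := by
  obtain ⟨X, hX, h⟩ := Finset.exists_mem_eq_sup' (s := S.powerset)
    ⟨∅, Finset.empty_mem_powerset S⟩ (φ.revenue r)
  exact ⟨X, Finset.mem_powerset.mp hX, h⟩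

theorem optRevenue_nonneg (S : Finset (Fin n)) : 0 ≤ φ.optRevenue r S :=
  φ.revenue_empty r ▸ φ.revenue_le_optRevenue r (Finset.empty_subset S)

theorem optRevenue_empty : φ.optRevenue r ∅ = 0 := by
  simp [optRevenue, revenue_empty]

theorem optRevenue_mono : Monotone (φ.optRevenue r) := fun S T h => by
  obtain ⟨X, hX, hS⟩ := φ.exists_optRevenue_eq r S
  rw [hS]
  exact φ.revenue_le_optRevenue r (hX.trans h)

/-- The products whose price is at least the optimal revenue form an optimal assortment. -/
theorem optRevenue_eq_revenue_filter (S : Finset (Fin n)) :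
    φ.optRevenue r S = φ.revenue r (S.filter fun i => φ.optRevenue r S ≤ r i) := by
  refine le_antisymm ?_ (φ.revenue_le_optRevenue r (Finset.filter_subset _ _))
  have h0 := φ.optRevenue_nonneg r S
  obtain ⟨X, hX, hXS⟩ := φ.exists_optRevenue_eq r S
  set l := φ.optRevenue r S with hl
  set Y := S.filter fun i => l ≤ r i with hY
  rcases h0.eq_or_lt with h0 | h0
  -- At optimal revenue 0 the filter keeps only nonnegative prices, so no sign of the denominator is
  -- needed.
  · rw [← h0]
    refine Finset.sum_nonneg fun i hi => mul_nonneg ?_ (φ.choiceProb_nonneg _ _)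
    exact h0.le.trans (Finset.mem_filter.mp hi).2
  -- Linearization: revenue at least `l` amounts to this sum being at least `l * v₀`, and the sum is
  -- largest when exactly the terms with `l ≤ r i` are kept.
  have hsum : ∀ Z : Finset (Fin n), ∑ i ∈ Z, φ.v i * (r i - l) =
      ∑ i ∈ Z, r i * φ.v i - l * φ.den Z + l * φ.v₀ := by
    intro Z
    rw [den, mul_add, Finset.mul_sum]
    rw [show ∑ i ∈ Z, φ.v i * (r i - l) = ∑ i ∈ Z, (r i * φ.v i - l * φ.v i) from
      Finset.sum_congr rfl fun i _ => by ring, Finset.sum_sub_distrib]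
    ring
  have hXsum : ∑ i ∈ X, φ.v i * (r i - l) = l * φ.v₀ := by
    rw [hsum, ← revenue_mul_den, ← hXS]
    ring
  have hle : ∑ i ∈ X, φ.v i * (r i - l) ≤ ∑ i ∈ Y, φ.v i * (r i - l) := by
    rw [hY, Finset.sum_filter]
    calc ∑ i ∈ X, φ.v i * (r i - l) ≤ ∑ i ∈ X, if l ≤ r i then φ.v i * (r i - l) else 0 := by
          refine Finset.sum_le_sum fun i _ => ?_
          split_ifs with h
          · exact le_rfl
          · exact mul_nonpos_of_nonneg_of_nonpos (φ.v_nonneg i) (by linarith)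
      _ ≤ _ := by
          refine Finset.sum_le_sum_of_subset_of_nonneg hX fun i _ _ => ?_
          split_ifs with h
          · exact mul_nonneg (φ.v_nonneg i) (sub_nonneg.mpr h)
          · exact le_rfl
  -- A zero denominator forces `v₀` and all weights on `Y` to vanish; equality in the linearized sum
  -- then kills the weights on `X` too, so `X` would earn 0 instead of `l > 0`.
  have hpos : 0 < φ.den Y := by
    refine (φ.den_nonneg Y).lt_of_ne' fun hz => ?_
    have hv₀ : φ.v₀ = 0 := le_antisymm
      (hz ▸ le_add_of_nonneg_right (Finset.sum_nonneg fun i _ => φ.v_nonneg i)) φ.v₀_nonneg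
    have hvY : ∀ i ∈ Y, φ.v i = 0 := fun i hi =>
      le_antisymm (hz ▸ φ.v_le_den hi) (φ.v_nonneg i)
    have hterm : ∀ i ∈ X, φ.v i * (r i - l) ≤ 0 := by
      intro i hi
      by_cases h : l ≤ r i
      · rw [hvY i (Finset.mem_filter.mpr ⟨hX hi, h⟩), zero_mul]
      · exact mul_nonpos_of_nonneg_of_nonpos (φ.v_nonneg i) (by linarith)
    rw [hv₀, mul_zero, Finset.sum_eq_zero_iff_of_nonpos hterm] at hXsum
    have hvX : ∀ i ∈ X, φ.v i = 0 := by
      intro i hi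
      by_cases h : l ≤ r i
      · exact hvY i (Finset.mem_filter.mpr ⟨hX hi, h⟩)
      · exact (mul_eq_zero.mp (hXsum i hi)).resolve_right (by linarith)
    have : φ.den X = 0 := by rw [den, hv₀, Finset.sum_eq_zero hvX, add_zero]
    rw [hXS, φ.revenue_eq_zero r this] at h0
    exact lt_irrefl _ h0
  rw [revenue_eq, le_div_iff₀ hpos]
  have := hsum Y
  linarith

theorem optRevenue_eq_revenue {S : Finset (Fin n)} (h : ∀ i ∈ S, φ.optRevenue r S ≤ r i) :
    φ.optRevenue r S = φ.revenue r S := by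
  have := φ.optRevenue_eq_revenue_filter r S
  rwa [Finset.filter_true_of_mem h] at this

/-- Split an optimal assortment of A ∪ B between `A` and `B`. All its prices are nonnegative, and
dropping products only raises the choice probabilities of those that remain. -/
theorem optRevenue_union_le (A B : Finset (Fin n)) :
    φ.optRevenue r (A ∪ B) ≤ φ.optRevenue r A + φ.optRevenue r B := by
  have h := φ.optRevenue_eq_revenue_filter r (A ∪ B)
  have h0 := φ.optRevenue_nonneg r (A ∪ B)
  set Y := (A ∪ B).filter fun i => φ.optRevenue r (A ∪ B) ≤ r i with hY
  have hr : ∀ i ∈ Y, 0 ≤ r i := fun i hi => h0.trans (Finset.mem_filter.mp hi).2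
  have key : ∀ Z ⊆ Y, ∑ i ∈ Z, r i * φ.choiceProb i Y ≤ φ.revenue r Z := fun Z hZ =>
    Finset.sum_le_sum fun i hi =>
      mul_le_mul_of_nonneg_left (φ.choiceProb_anti hZ hi) (hr i (hZ hi))
  have hU : Y = (Y ∩ A) ∪ (Y \ A) := by ext; simp; tauto
  have hsub : Y \ A ⊆ B := by
    intro i hi
    rw [Finset.mem_sdiff, hY, Finset.mem_filter, Finset.mem_union] at hi
    tauto
  have hs : φ.revenue r Y = ∑ i ∈ Y ∩ A, r i * φ.choiceProb i Y +
      ∑ i ∈ Y \ A, r i * φ.choiceProb i Y := by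
    rw [revenue, ← Finset.sum_inter_add_sum_sdiff Y A]
  have h₁ := (key _ Finset.inter_subset_left).trans
    (φ.revenue_le_optRevenue r (Finset.inter_subset_right (s₁ := Y) (s₂ := A)))
  have h₂ := (key _ Finset.sdiff_subset).trans (φ.revenue_le_optRevenue r hsub)
  linarith

variable {φ r} {π : Equiv.Perm (Fin n)}

/-- If `C` adds nothing to `A`, monotonicity suffices. Otherwise a product of `C` is worth offering,
and hence so is every product of `A`, being at least as expensive; all optima involved except that
of C ∪ B are then explicit fractions, and for C ∪ B the assortment B ∪ D is a lower bound. -/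
theorem isSubmodularOrder_optRevenue (hr : Antitone fun p => r (π p)) :
    IsSubmodularOrder π (φ.optRevenue r) := by
  intro A B C hBA hAC
  have hprice : ∀ a ∈ A, ∀ c ∈ C, r c ≤ r a := fun a ha c hc => by
    simpa using hr (hAC a ha c hc).le
  have hdisj : Disjoint A C := Finset.disjoint_left.mpr fun x hA hC => lt_irrefl _ (hAC x hA x hC)
  unfold marginal
  have hmA := φ.optRevenue_mono r (Finset.subset_union_right (s₁ := C) (s₂ := A))
  have hmB := φ.optRevenue_mono r (Finset.subset_union_right (s₁ := C) (s₂ := B))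
  have hBA' := φ.optRevenue_mono r hBA
  have hopt := φ.optRevenue_eq_revenue_filter r (C ∪ A)
  have ha0 := φ.optRevenue_nonneg r A
  rcases hmA.eq_or_lt with heq | hlt
  · linarith
  set l := φ.optRevenue r (C ∪ A) with hl
  set D := C.filter fun i => l ≤ r i with hD
  have hDC : D ⊆ C := Finset.filter_subset _ _
  -- Were no product of `C` priced at least `l`, an optimal assortment of C ∪ A would lie inside
  -- `A`.
  have hDne : D.Nonempty := by
    rw [Finset.nonempty_iff_ne_empty]
    intro hempty
    have hsub : ((C ∪ A).filter fun i => l ≤ r i) ⊆ A := by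
      rw [Finset.filter_union, ← hD, hempty, Finset.empty_union]
      exact Finset.filter_subset _ _
    have := φ.revenue_le_optRevenue r hsub
    linarith
  obtain ⟨c, hc⟩ := hDne
  have hAl : ∀ a ∈ A, l ≤ r a := fun a ha =>
    (Finset.mem_filter.mp hc).2.trans (hprice a ha c (hDC hc))
  have hA := φ.optRevenue_eq_revenue r fun a ha => hlt.le.trans (hAl a ha)
  have hB := φ.optRevenue_eq_revenue r fun b hb => hBA'.trans (hlt.le.trans (hAl b (hBA hb)))
  have hY : ((C ∪ A).filter fun i => l ≤ r i) = A ∪ D := by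
    rw [Finset.filter_union, ← hD, Finset.filter_true_of_mem hAl, Finset.union_comm]
  rw [hY] at hopt
  have hAD : Disjoint A D := hdisj.mono_right hDC
  have hBD : Disjoint B D := hAD.mono_left hBA
  have hμ : φ.revenue r (B ∪ D) ≤ φ.optRevenue r (C ∪ B) :=
    φ.revenue_le_optRevenue r (Finset.union_comm C B ▸ Finset.union_subset_union_right hDC)
  have eA := φ.revenue_mul_den r A
  have eB := φ.revenue_mul_den r B
  have eAD := φ.revenue_mul_den r (A ∪ D)
  have eBD := φ.revenue_mul_den r (B ∪ D)
  rw [φ.den_union hAD, Finset.sum_union hAD, ← eA, ← hopt, ← hA] at eAD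
  rw [φ.den_union hBD, Finset.sum_union hBD, ← eB, ← hB] at eBD
  set VC := ∑ e ∈ D, φ.v e with hVC
  set NC := ∑ i ∈ D, r i * φ.v i with hNC
  have hVBA := φ.den_mono hBA
  have hVB := φ.den_nonneg B
  have hVC0 : 0 ≤ VC := Finset.sum_nonneg fun i _ => φ.v_nonneg i
  have hAD0 : φ.den A + VC ≠ 0 := by
    intro h
    rw [← φ.den_union hAD] at h
    rw [φ.revenue_eq_zero r h] at hopt
    linarith
  have hVCpos : 0 < VC := by
    refine hVC0.lt_of_ne' fun h => ?_
    have hN : NC = 0 := Finset.sum_eq_zero fun i hi => by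
      rw [(Finset.sum_eq_zero_iff_of_nonneg fun i _ => φ.v_nonneg i).mp h i hi, mul_zero]
    rw [h, hN, add_zero, add_zero] at eAD
    rw [h, add_zero] at hAD0
    exact hlt.ne' (mul_right_cancel₀ hAD0 eAD)
  -- By `eAD` and `eBD`, (l - f(A)) den A = NC - l VC and the right side equals NC - f(B) VC.
  -- Replacing den B by den A on the left gives at most NC - f(A) VC, and f(B) ≤ f(A).
  have hfin : (l - φ.optRevenue r A) * (φ.den B + VC) ≤
      (φ.revenue r (B ∪ D) - φ.optRevenue r B) * (φ.den B + VC) := by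
    have h₁ := mul_le_mul_of_nonneg_left hVBA (sub_nonneg.mpr hlt.le)
    have h₂ := mul_le_mul_of_nonneg_right hBA' hVC0
    linarith
  have := le_of_mul_le_mul_right hfin (by linarith)
  linarith

/-- Every assortment of the form required by `optRevenue_eq_revenue_filter` is an initial segment
in an order by descending price. -/
theorem optRevenue_eq_initial_segment (hr : Antitone fun p => r (π p)) (S : Finset (Fin n)) :
    φ.optRevenue r S = 0 ∨ ∃ i ∈ S,
      φ.optRevenue r S = φ.revenue r (S.filter fun e => π.symm e ≤ π.symm i) := by
  have h := φ.optRevenue_eq_revenue_filter r S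
  set Y := S.filter fun i => φ.optRevenue r S ≤ r i with hY
  rcases Y.eq_empty_or_nonempty with hE | hne
  · rw [hE, revenue_empty] at h
    exact .inl h
  · obtain ⟨i, hi, hmax⟩ := Finset.exists_max_image Y π.symm hne
    obtain ⟨hiS, hil⟩ := Finset.mem_filter.mp hi
    refine .inr ⟨i, hiS, ?_⟩
    have : (S.filter fun e => π.symm e ≤ π.symm i) = Y := by
      ext e
      rw [hY, Finset.mem_filter, Finset.mem_filter]
      refine and_congr_right fun he => ⟨fun h => ?_, fun h => ?_⟩
      · exact hil.trans (by simpa using hr h)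
      · exact hmax e (Finset.mem_filter.mpr ⟨he, h⟩)
    rw [this]
    exact h

theorem evalOptRevenue_val (hr : Antitone fun p => r (π p)) (S : Finset (Fin n)) :
    (evalOptRevenue φ r π S).val = φ.optRevenue r S := by
  simp only [evalOptRevenue, Counted.bind_val, Counted.pure_val, Counted.foldlM_val]
  have key := foldl_induction (pairwise_orderedList π)
    (g := fun (s : ℝ × ℝ × ℝ) i => if i ∈ S then
      (s.1 + r i * φ.v i, s.2.1 + φ.v i, max s.2.2 ((s.1 + r i * φ.v i) / (s.2.1 + φ.v i))) else s)
    -- The last clause intersects segments with `D` so that it is meaningful midway; a segment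
    -- ending in `D` no longer changes when `D` grows.
    (fun D s => s.1 = ∑ i ∈ S ∩ D, r i * φ.v i ∧ s.2.1 = φ.den (S ∩ D) ∧
      0 ≤ s.2.2 ∧ s.2.2 ≤ φ.optRevenue r S ∧
      ∀ i ∈ S ∩ D, φ.revenue r (S.filter (fun e => π.symm e ≤ π.symm i) ∩ D) ≤ s.2.2)
    (s := (0, φ.v₀, 0)) (by simp [den, optRevenue_nonneg]) (by
      rintro D ⟨num, d, best⟩ j - hj ⟨h₁, h₂, h₃, h₄, h₅⟩
      dsimp only at h₁ h₂ h₃ h₄ h₅ ⊢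
      have hjD : j ∉ D := fun h => lt_irrefl _ (hj j h)
      have hseg : ∀ i ∈ D, S.filter (fun e => π.symm e ≤ π.symm i) ∩ insert j D =
          S.filter (fun e => π.symm e ≤ π.symm i) ∩ D := fun i hi =>
        Finset.inter_insert_of_notMem fun h => absurd (Finset.mem_filter.mp h).2 (hj i hi).not_ge
      split_ifs with hjS
      · rw [Finset.inter_insert_of_mem hjS]
        have hjSD : j ∉ S ∩ D := fun h => hjD (Finset.mem_inter.mp h).2
        have e₁ : num + r j * φ.v j = ∑ i ∈ insert j (S ∩ D), r i * φ.v i := by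
          rw [Finset.sum_insert hjSD, h₁, add_comm]
        have e₂ : d + φ.v j = φ.den (insert j (S ∩ D)) := by
          rw [den, Finset.sum_insert hjSD, h₂, den]
          ring
        have hsub : insert j (S ∩ D) ⊆ S := Finset.insert_subset hjS Finset.inter_subset_left
        refine ⟨e₁, e₂, le_max_of_le_left h₃, max_le h₄ ?_, ?_⟩
        · rw [e₁, e₂, ← revenue_eq]
          exact φ.revenue_le_optRevenue r hsub
        · intro i hi
          rcases Finset.mem_insert.mp hi with rfl | hi
          · refine le_max_of_le_right (le_of_eq ?_)
            rw [e₁, e₂, ← revenue_eq]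
            congr 1
            ext e
            simp only [Finset.mem_inter, Finset.mem_filter, Finset.mem_insert]
            constructor
            · tauto
            · rintro (rfl | ⟨h, h'⟩)
              · exact ⟨⟨hjS, le_rfl⟩, .inl rfl⟩
              · exact ⟨⟨h, (hj e h').le⟩, .inr h'⟩
          · rw [hseg i (Finset.mem_inter.mp hi).2]
            exact le_max_of_le_left (h₅ i hi)
      · rw [Finset.inter_insert_of_notMem hjS]
        refine ⟨h₁, h₂, h₃, h₄, fun i hi => ?_⟩
        rw [hseg i (Finset.mem_inter.mp hi).2]
        exact h₅ i hi)
  rw [toFinset_orderedList] at key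
  obtain ⟨-, -, h₃, h₄, h₅⟩ := key
  refine le_antisymm ?_ ?_
  · exact h₄
  · rcases optRevenue_eq_initial_segment (φ := φ) hr S with h | ⟨i, hi, h⟩
    · rw [h]
      exact h₃
    · rw [h]
      simpa only [Finset.inter_univ] using h₅ i (by simpa using hi)

theorem evalOptRevenue_cost_le (S : Finset (Fin n)) :
    (evalOptRevenue φ r π S).cost ≤ n * 6 := by
  simp only [evalOptRevenue, Counted.bind_cost, Counted.pure_cost, add_zero]
  refine (Counted.foldlM_cost_le (fun _ => True) (fun _ _ _ => trivial) (fun _ _ _ => ?_) _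
    trivial).trans (by rw [length_orderedList])
  simp

end MNL

namespace MNLMixture

variable {n m : ℕ} {P : MNLMixture n m} {r : Fin n → ℝ} {π : Equiv.Perm (Fin n)}

theorem isSubmodularOrderFunction_objective (hr : Antitone fun p => r (π p)) :
    IsSubmodularOrderFunction π (P.objective r) where
  map_empty := by simp [objective, MNL.optRevenue_empty]
  monotone S T h := Finset.sum_le_sum fun j _ =>
    mul_le_mul_of_nonneg_left ((P.φ j).optRevenue_mono r h) (P.α_nonneg j)
  subadditive A B := by
    rw [objective, objective, objective, ← Finset.sum_add_distrib]
    refine Finset.sum_le_sum fun j _ => ?_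
    rw [← mul_add]
    exact mul_le_mul_of_nonneg_left ((P.φ j).optRevenue_union_le r A B) (P.α_nonneg j)
  submodularOrder A B C hBA hAC := by
    simp only [marginal, objective, ← Finset.sum_sub_distrib, ← mul_sub]
    exact Finset.sum_le_sum fun j _ => mul_le_mul_of_nonneg_left
      (MNL.isSubmodularOrder_optRevenue (φ := P.φ j) hr A B C hBA hAC) (P.α_nonneg j)

theorem evalObjective_val (hr : Antitone fun p => r (π p)) (S : Finset (Fin n)) :
    (evalObjective P r π S).val = P.objective r S := by
  rw [evalObjective, Counted.foldlM_val]
  simp only [Counted.bind_val, Counted.pure_val, MNL.evalOptRevenue_val hr]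
  rw [objective, ← List.sum_ofFn, List.sum_eq_foldl, List.ofFn_eq_map, List.foldl_map]

theorem evalObjective_cost_le (S : Finset (Fin n)) :
    (evalObjective P r π S).cost ≤ m * (n * 6 + 2) := by
  refine (Counted.foldlM_cost_le (fun _ => True) (fun _ _ _ => trivial) (c := n * 6 + 2)
    (fun x j _ => ?_) _ trivial).trans (by rw [List.length_finRange])
  have := MNL.evalOptRevenue_cost_le (φ := P.φ j) (r := r) (π := π) S
  simpa using this

end MNLMixture

/-! ### Geometric grids of thresholds -/

section Grid

variable {ε : ℝ} {N : ℕ}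

theorem le_pow_gridSize (hε : 0 < ε) (hN : 1 ≤ N) : (N : ℝ) ≤ (1 + ε) ^ gridSize ε N := by
  have h := Nat.le_ceil (Real.logb (1 + ε) N)
  rw [Real.logb_le_iff_le_rpow (by linarith) (by exact_mod_cast hN), Real.rpow_natCast] at h
  exact h

theorem pow_lt_of_lt_gridSize (hε : 0 < ε) (hN : 1 ≤ N) {i : ℕ} (hi : i < gridSize ε N) :
    (1 + ε) ^ i < (N : ℝ) := by
  have h := Nat.lt_ceil.mp hi
  rwa [Real.lt_logb_iff_rpow_lt (by linarith) (by exact_mod_cast hN), Real.rpow_natCast] at h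

theorem gridSize_mono (hε : 0 < ε) {L : ℕ} (h : L ≤ N) : gridSize ε L ≤ gridSize ε N := by
  rcases Nat.eq_zero_or_pos L with rfl | hL
  · simp [gridSize]
  · exact Nat.ceil_mono (Real.logb_le_logb_of_le (by linarith) (by exact_mod_cast hL)
      (by exact_mod_cast h))

theorem half_le_log_add_one (hN : 1 ≤ N) : 1 / 2 ≤ Real.log ((N : ℝ) + 1) := by
  have h : (1 : ℝ) ≤ N := by exact_mod_cast hN
  have := Real.log_le_log (by norm_num : (0 : ℝ) < 2) (by linarith : (2 : ℝ) ≤ (N : ℝ) + 1)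
  linarith [Real.log_two_gt_d9]

/-- From 1 - 1/x ≤ log x and ε < 1, log(1 + ε) ≥ ε/2. The rounding term 1 is absorbed because log(N
+ 1) ≥ 1/2, even at N = 1. -/
theorem max_one_gridSize_le (hε : 0 < ε) (hε1 : ε < 1) (hN : 1 ≤ N) :
    ((max 1 (gridSize ε N) : ℕ) : ℝ) ≤ 4 * (Real.log ((N : ℝ) + 1) / ε) := by
  have hN' : (1 : ℝ) ≤ N := by exact_mod_cast hN
  have hhalf := half_le_log_add_one hN
  have hlogN : Real.log N ≤ Real.log ((N : ℝ) + 1) :=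
    Real.log_le_log (by linarith) (by linarith)
  have hlog : ε / 2 ≤ Real.log (1 + ε) := by
    have h := Real.one_sub_inv_le_log_of_pos (x := 1 + ε) (by linarith)
    refine le_trans ?_ h
    rw [← sub_nonneg, show 1 - (1 + ε)⁻¹ - ε / 2 = ε * (1 - ε) / (2 * (1 + ε)) by
      field_simp; ring]
    exact div_nonneg (mul_nonneg hε.le (by linarith)) (by linarith)
  have hlogb : Real.logb (1 + ε) N ≤ 2 * (Real.log ((N : ℝ) + 1) / ε) := by
    rw [Real.logb, div_le_iff₀ (by linarith)]
    calc Real.log N ≤ Real.log ((N : ℝ) + 1) := hlogN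
      _ = 2 * (Real.log ((N : ℝ) + 1) / ε) * (ε / 2) := by field_simp
      _ ≤ _ := mul_le_mul_of_nonneg_left hlog
        (mul_nonneg zero_le_two (div_nonneg (by linarith) hε.le))
  have hone : 1 ≤ 2 * (Real.log ((N : ℝ) + 1) / ε) := by
    rw [← mul_div_assoc, le_div_iff₀ hε]
    linarith
  have hceil : (gridSize ε N : ℝ) < Real.logb (1 + ε) N + 1 :=
    Nat.ceil_lt_add_one (Real.logb_nonneg (by linarith) hN')
  rw [Nat.cast_max, Nat.cast_one]
  exact max_le (by linarith) (by linarith)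

end Grid

/-! ### Cardinality constraint -/

section Cardinality

variable {n : ℕ} {π : Equiv.Perm (Fin n)} {f : Finset (Fin n) → ℝ}

/-- Each test compares `τ` with the gain in the final set, which later insertions leave unchanged.
Rejections are informative only if the pass never reached `k` elements. -/
theorem thresholdAdd_spec (π : Equiv.Perm (Fin n)) (f : Finset (Fin n) → ℝ) (k : ℕ) (τ : ℝ) :
    let S := (thresholdAdd (valueOracle f) π k τ).val
    S.card ≤ k ∧ (∀ e ∈ S, τ ≤ gain π f S e) ∧ (S.card < k → ∀ e ∉ S, gain π f S e < τ) := by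
  rw [thresholdAdd, Counted.foldlM_val]
  have key := foldl_induction (pairwise_orderedList π)
    (g := fun S i => (if S.card < k then do
      let d ← askMarginal (valueOracle f) i S
      pure (if τ ≤ d then insert i S else S) else pure S : Counted (Finset (Fin n))).val)
    (fun D S => S ⊆ D ∧ S.card ≤ k ∧ (∀ e ∈ S, τ ≤ gain π f S e) ∧
      (S.card < k → ∀ e ∈ D, e ∉ S → gain π f S e < τ)) (s := ∅) (by simp) (by
      rintro D S j - hj ⟨hSD, hk, hin, hout⟩
      have hjS : ∀ a ∈ S, π.symm a < π.symm j := fun a ha => hj a (hSD ha)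
      have hjS' : j ∉ S := fun h => lt_irrefl _ (hjS j h)
      split_ifs with hc
      · simp only [Counted.bind_val, Counted.pure_val]
        split_ifs with hd <;> rw [askMarginal_val] at hd
        · refine ⟨Finset.insert_subset_insert _ hSD, ?_, ?_, ?_⟩
          · rw [Finset.card_insert_of_notMem hjS']
            exact hc
          · intro e he
            rcases Finset.mem_insert.mp he with rfl | he
            · rwa [gain_insert_self hjS]
            · rw [gain_insert_of_le (hjS e he).le]
              exact hin e he
          · intro _ e he heS
            rw [Finset.mem_insert, not_or] at heS
            have heD := (Finset.mem_insert.mp he).resolve_left heS.1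
            rw [gain_insert_of_le (hj e heD).le]
            exact hout hc e heD heS.2
        · refine ⟨hSD.trans (Finset.subset_insert _ _), hk, hin, fun _ e he heS => ?_⟩
          rcases Finset.mem_insert.mp he with rfl | he
          · rw [gain_eq hjS]
            exact not_le.mp hd
          · exact hout hc e he heS
      · exact ⟨hSD.trans (Finset.subset_insert _ _), hk, hin, fun h => absurd h hc⟩)
  rw [toFinset_orderedList] at key
  exact ⟨key.2.1, key.2.2.1, fun h e => key.2.2.2 h e (Finset.mem_univ e)⟩

theorem thresholdAdd_cost_le (k : ℕ) (τ : ℝ) :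
    (thresholdAdd (valueOracle f) π k τ).cost ≤ n * 2 := by
  refine (Counted.foldlM_cost_le (fun _ => True) (fun _ _ _ => trivial) (c := 2)
    (fun S i _ => ?_) _ trivial).trans (by rw [length_orderedList])
  split_ifs <;> simp

theorem sum_threshold_le {S : Finset (Fin n)} (hf : IsSubmodularOrderFunction π f) {τ : ℝ}
    (h : ∀ e ∈ S, τ ≤ gain π f S e) : S.card * τ ≤ f S := by
  rw [← sum_gain (π := π) hf.map_empty S, ← nsmul_eq_mul]
  exact Finset.card_nsmul_le_sum _ _ _ h

theorem thresholdAdd_ge_or (hf : IsSubmodularOrderFunction π f) {k : ℕ} {τ : ℝ} (hτ : 0 ≤ τ)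
    {T : Finset (Fin n)} (hT : T.card ≤ k) :
    k * τ ≤ f (thresholdAdd (valueOracle f) π k τ).val ∨
      f T ≤ f (thresholdAdd (valueOracle f) π k τ).val + k * τ := by
  obtain ⟨h₁, h₂, h₃⟩ := thresholdAdd_spec π f k τ
  set S := (thresholdAdd (valueOracle f) π k τ).val
  rcases h₁.eq_or_lt with h | h
  · left
    rw [← h]
    exact sum_threshold_le hf h₂
  · right
    refine (hf.le_add_sum_gain S T).trans (add_le_add_right ?_ _)
    refine (Finset.sum_le_card_nsmul _ _ τ fun e he =>
      (h₃ h e (Finset.mem_sdiff.mp he).2).le).trans ?_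
    rw [nsmul_eq_mul]
    refine mul_le_mul_of_nonneg_right ?_ hτ
    exact_mod_cast (Finset.card_le_card Finset.sdiff_subset).trans hT

/-- An empty output would have rejected `e`, whose gain would be f({e}) ≥ τ. This covers optima too
small for the grid. -/
theorem le_thresholdAdd (hf : IsSubmodularOrderFunction π f) {k : ℕ} (hk : 1 ≤ k) {τ : ℝ}
    (hτ : 0 ≤ τ) {e : Fin n} (he : τ ≤ f {e}) :
    τ ≤ f (thresholdAdd (valueOracle f) π k τ).val := by
  obtain ⟨-, h₂, h₃⟩ := thresholdAdd_spec π f k τ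
  set S := (thresholdAdd (valueOracle f) π k τ).val
  have hS : S.Nonempty := by
    rw [Finset.nonempty_iff_ne_empty]
    intro hS
    have := h₃ (by rw [hS, Finset.card_empty]; exact hk) e (by simp [hS])
    rw [hS, gain_eq (by simp), insert_empty_eq, hf.map_empty] at this
    linarith
  refine le_trans ?_ (sum_threshold_le hf h₂)
  have : (1 : ℝ) ≤ S.card := by exact_mod_cast hS.card_pos
  nlinarith

theorem cardinalityAlg_isApproxMax (hf : IsSubmodularOrderFunction π f) {k : ℕ} {ε : ℝ}
    (hk : 1 ≤ k) (hε : 0 < ε) (hε1 : ε < 1) :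
    IsApproxMax ((1 - ε) * (1 / 2)) (fun S => S.card ≤ k) f
      (cardinalityAlg (valueOracle f) π k ε).val := by
  obtain ⟨hM0, hM, hMe⟩ := maxSingleton_spec f (orderedList π)
  simp only [cardinalityAlg, Counted.bind_val, Counted.mapM_val]
  set M := (maxSingleton (valueOracle f) (orderedList π)).val
  set J := max 1 (gridSize ε k) with hJ
  set sets := (List.range J).map fun i =>
    (thresholdAdd (valueOracle f) π k ((1 + ε) ^ i * (M / k))).val with hsets
  have hne : sets ≠ [] := by
    rw [hsets, Ne, List.map_eq_nil_iff, List.range_eq_nil]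
    exact (lt_max_of_lt_left one_pos).ne'
  obtain ⟨hmem, hbest⟩ := bestOf_spec f hne
  have hbest' : ∀ i < J, f (thresholdAdd (valueOracle f) π k ((1 + ε) ^ i * (M / k))).val ≤
      f (bestOf (valueOracle f) sets).val := fun i hi =>
    hbest _ (List.mem_map.mpr ⟨i, List.mem_range.mpr hi, rfl⟩)
  have hk0 : (0 : ℝ) < k := by exact_mod_cast hk
  have hk1 : (1 : ℝ) ≤ k := by exact_mod_cast hk
  have hτ : ∀ i : ℕ, 0 ≤ (1 + ε) ^ i * (M / k) := fun i => by positivity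
  have hmul : ∀ i : ℕ, (k : ℝ) * ((1 + ε) ^ i * (M / k)) = (1 + ε) ^ i * M := fun i => by
    field_simp
  constructor
  · obtain ⟨i, -, hi⟩ := List.mem_map.mp hmem
    rw [← hi]
    exact (thresholdAdd_spec π f k _).1
  intro T hT
  set V := f (bestOf (valueOracle f) sets).val
  have hV0 : 0 ≤ V := hf.nonneg _
  have hT0 := hf.nonneg T
  have hTM : f T ≤ k * M := (hf.le_card_mul fun e _ => hM e (mem_orderedList π e)).trans
    (mul_le_mul_of_nonneg_right (by exact_mod_cast hT) hM0)
  rcases hMe with hM00 | ⟨e, -, he⟩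
  · rw [hM00, mul_zero] at hTM
    nlinarith
  have hpow : (k : ℝ) ≤ (1 + ε) ^ J :=
    (le_pow_gridSize hε hk).trans (pow_le_pow_right₀ (by linarith) (le_max_right _ _))
  have hpow' : (1 + ε) ^ (J - 1) ≤ (k : ℝ) := by
    rcases Nat.eq_zero_or_pos (gridSize ε k) with h | h
    · have : J = 1 := by rw [hJ, h]; rfl
      simpa [this] using hk1
    · have : J = gridSize ε k := max_eq_right h
      exact (pow_lt_of_lt_gridSize hε hk (by omega)).le
  have hJ1 : J - 1 + 1 = J := Nat.sub_add_cancel (le_max_left _ _)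
  -- The smallest threshold has k τ = M, so OPT/2 < M is below the grid. There the top threshold
  -- works: it lies between (1 - ε) M and `M`, so a single selected element suffices.
  rcases le_or_gt (f T) (2 * M) with hsmall | hbig
  · have htop : (1 + ε) ^ (J - 1) * (M / k) ≤ f {e} := by
      rw [he, ← mul_div_assoc, div_le_iff₀ hk0, mul_comm M]
      exact mul_le_mul_of_nonneg_right hpow' hM0
    have h₁ := (le_thresholdAdd hf hk (hτ (J - 1)) htop).trans (hbest' (J - 1) (by omega))
    have h₂ : (1 - ε) * M ≤ (1 + ε) ^ (J - 1) * (M / k) := by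
      rw [← mul_div_assoc, le_div_iff₀ hk0]
      rw [← hJ1, pow_succ] at hpow
      have hp : 0 < (1 + ε) ^ (J - 1) := by positivity
      have : (1 - ε) * k ≤ (1 + ε) ^ (J - 1) := by
        refine (mul_le_mul_of_nonneg_left hpow (by linarith)).trans ?_
        nlinarith [mul_pos hp (mul_pos hε hε)]
      nlinarith
    nlinarith
  · have hMpos : 0 < M := by
      refine hM0.lt_of_ne' fun h => ?_
      rw [h, mul_zero] at hTM hbig
      linarith
    -- Choose k τ ≤ f(T)/2 < (1 + ε) k τ. A full set loses at most (1 - ε)(1 + ε) ≤ 1; a set that is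
    -- not full has value at least f(T)/2.
    obtain ⟨i, hi₁, hi₂⟩ := exists_nat_pow_near (x := f T / (2 * M)) (y := 1 + ε)
      (by rw [one_le_div (by linarith)]; exact hbig.le) (by linarith)
    rw [le_div_iff₀ (by linarith)] at hi₁
    rw [div_lt_iff₀ (by linarith), pow_succ] at hi₂
    have hiJ : i < J := by
      by_contra hcon
      have h₁ := hpow.trans (pow_le_pow_right₀ (by linarith : 1 ≤ 1 + ε) (not_lt.mp hcon))
      nlinarith
    have hor := thresholdAdd_ge_or hf (hτ i) hT
    rw [hmul] at hor
    have hb := hbest' i hiJ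
    rcases hor with h | h
    · have hVi := h.trans hb
      set x := (1 + ε) ^ i * M
      have h₁ : f T < 2 * ((1 + ε) * x) := by rw [show 2 * ((1 + ε) * x) =
        (1 + ε) ^ i * (1 + ε) * (2 * M) by ring]; exact hi₂
      have hx : 0 ≤ x := by positivity
      have h₂ : (1 - ε) * f T ≤ (1 - ε) * (2 * ((1 + ε) * x)) :=
        mul_le_mul_of_nonneg_left h₁.le (by linarith)
      nlinarith [mul_nonneg hx (mul_self_nonneg ε)]
    · nlinarith

theorem cardinalityAlg_cost_le {k : ℕ} {ε : ℝ} (hn : 0 < n) (hk : 1 ≤ k) (hε : 0 < ε)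
    (hε1 : ε < 1) : ((cardinalityAlg (valueOracle f) π k ε).cost : ℝ) ≤
      16 * ((n : ℝ) / ε * Real.log ((k : ℝ) + 1)) := by
  have hJ := max_one_gridSize_le hε hε1 hk
  have hJ1 : 1 ≤ max 1 (gridSize ε k) := le_max_left _ _
  have hcost : (cardinalityAlg (valueOracle f) π k ε).cost ≤ 4 * (n * max 1 (gridSize ε k)) := by
    simp only [cardinalityAlg, Counted.bind_cost, Counted.mapM_val]
    set J := max 1 (gridSize ε k)
    have h₁ := maxSingleton_cost_le (f := f) (orderedList π)
    set M := (maxSingleton (valueOracle f) (orderedList π)).val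
    have h₂ := Counted.mapM_cost_le (g := fun i =>
      thresholdAdd (valueOracle f) π k ((1 + ε) ^ i * (M / k))) (fun i => thresholdAdd_cost_le k _)
      (List.range J)
    have h₃ := bestOf_cost_le (f := f) ((List.range J).map fun i =>
      (thresholdAdd (valueOracle f) π k ((1 + ε) ^ i * (M / k))).val)
    rw [length_orderedList] at h₁
    rw [List.length_range] at h₂
    rw [List.length_map, List.length_range] at h₃
    have h₄ : n * 1 ≤ n * J := Nat.mul_le_mul_left n hJ1
    have h₅ : 1 * J ≤ n * J := Nat.mul_le_mul_right J hn
    have h₆ : J * (n * 2) = 2 * (n * J) := by ring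
    omega
  calc ((cardinalityAlg (valueOracle f) π k ε).cost : ℝ)
      ≤ 4 * (n * (max 1 (gridSize ε k) : ℕ)) := by exact_mod_cast hcost
    _ ≤ 4 * (n * (4 * (Real.log ((k : ℝ) + 1) / ε))) := by gcongr
    _ = _ := by ring

end Cardinality

/-! ### Budget constraint -/

section Budget

variable {n : ℕ} {π : Equiv.Perm (Fin n)} {f : Finset (Fin n) → ℝ} {b : Fin n → ℝ} {B ε : ℝ}

theorem weight_mono (hb : ∀ i, 0 ≤ b i) {S T : Finset (Fin n)} (h : S ⊆ T) :
    weight b S ≤ weight b T :=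
  Finset.sum_le_sum_of_subset_of_nonneg h fun i _ _ => hb i

theorem weight_insert {S : Finset (Fin n)} {j : Fin n} (h : j ∉ S) :
    weight b (insert j S) = b j + weight b S := Finset.sum_insert h

theorem le_weight (hb : ∀ i, 0 ≤ b i) {S : Finset (Fin n)} {i : Fin n} (h : i ∈ S) :
    b i ≤ weight b S := Finset.single_le_sum (f := b) (fun i _ => hb i) h

theorem mul_weight_le (hf : IsSubmodularOrderFunction π f) {τ : ℝ} {S T : Finset (Fin n)}
    (hST : S ⊆ T) (h : ∀ e ∈ S, τ * b e ≤ gain π f T e) : τ * weight b S ≤ f S := by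
  rw [weight, Finset.mul_sum]
  exact (Finset.sum_le_sum h).trans (hf.sum_gain_le hST)

/-- If everything outside a feasible set `X` is light, making room for `j` costs less than `ε * B`
of the budget. -/
theorem finalAdd_spec (hb : ∀ i, 0 ≤ b i) (hε : 0 < ε) (hB : 0 < B)
    {X S : Finset (Fin n)} {j : Fin n} (hX : weight b X ≤ B) (hS : weight b S ≤ B)
    (hlight : ∀ e ∈ insert j S, e ∉ X → b e < ε * B) (hjS : j ∉ S)
    (hover : B < b j + weight b S) :
    finalAdd π b B ε S j ⊆ insert j S ∧ weight b (finalAdd π b B ε S j) ≤ B ∧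
      (1 - ε) * B ≤ weight b (finalAdd π b B ε S j) := by
  classical
  have hεB : 0 < ε * B := mul_pos hε hB
  have key := foldl_induction (pairwise_orderedList π)
    (g := fun T i => if i ∈ T ∧ b i < ε * B ∧ B < b j + weight b T then T.erase i else T)
    -- An element is removed only while the weight with `j` exceeds `B`, and it weighs less than ε
    -- B, so the total stays above (1 - ε) B.
    (fun D T => T ⊆ S ∧ (1 - ε) * B < b j + weight b T ∧
      (B < b j + weight b T → ∀ i ∈ D, i ∈ T → ε * B ≤ b i)) (s := S)
    ⟨subset_rfl, by linarith, by simp⟩ (by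
      rintro D T i - hi ⟨h₁, h₂, h₃⟩
      split_ifs with hc
      · obtain ⟨hiT, hbi, hw⟩ := hc
        have hw' : b i + weight b (T.erase i) = weight b T := Finset.add_sum_erase T b hiT
        refine ⟨(Finset.erase_subset _ _).trans h₁, by linarith, fun h k hk hkT => ?_⟩
        obtain ⟨hki, hkT⟩ := Finset.mem_erase.mp hkT
        exact h₃ hw k ((Finset.mem_insert.mp hk).resolve_left hki) hkT
      · refine ⟨h₁, h₂, fun h k hk hkT => ?_⟩
        rcases Finset.mem_insert.mp hk with rfl | hk
        · exact not_lt.mp fun hlt => hc ⟨hkT, hlt, h⟩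
        · exact h₃ h k hk hkT)
  rw [toFinset_orderedList] at key
  rw [finalAdd]
  obtain ⟨h₁, h₂, h₃⟩ := key
  set T := (orderedList π).foldl
    (fun T i => if i ∈ T ∧ b i < ε * B ∧ B < b j + weight b T then T.erase i else T) S with hT
  have hjT : j ∉ T := fun h => hjS (h₁ h)
  split_ifs with hfit
  · rw [weight_insert hjT]
    exact ⟨Finset.insert_subset_insert _ h₁, hfit, h₂.le⟩
  -- If `j` still does not fit, only heavy elements remain, all from `X`. Then `j` is not in `X`,
  -- since `X` is feasible; so `j` is light and what remains already weighs at least (1 - ε) B.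
  · have h₃ := h₃ (not_le.mp hfit)
    have hTX : T ⊆ X := by
      intro e he
      by_contra heX
      have h₄ := hlight e (Finset.mem_insert_of_mem (h₁ he)) heX
      have h₅ := h₃ e (Finset.mem_univ _) he
      linarith
    have hjX : j ∉ X := by
      intro hjX
      have := weight_mono hb (Finset.insert_subset hjX hTX)
      rw [weight_insert hjT] at this
      linarith
    have h₆ := hlight j (Finset.mem_insert_self _ _) hjX
    refine ⟨h₁.trans (Finset.subset_insert _ _), (weight_mono hb h₁).trans hS, ?_⟩
    linarith

theorem budgetThresholdAdd_spec (hf : IsSubmodularOrderFunction π f) (hb : ∀ i, 0 ≤ b i)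
    (hε : 0 < ε) (hB : 0 < B) {X : Finset (Fin n)} (hX : weight b X ≤ B) {L : List (Fin n)}
    (hL : L.Pairwise fun a b => π.symm a < π.symm b) (hlight : ∀ e ∈ L, e ∉ X → b e < ε * B)
    {τ : ℝ} (hτ : 0 ≤ τ) :
    let S := (budgetThresholdAdd (valueOracle f) π b B ε L τ).val
    weight b S ≤ B ∧ ((1 - ε) * (τ * B) ≤ f S ∨
      ∀ T : Finset (Fin n), (∀ e ∈ T, e ∈ L) → weight b T ≤ B → f T ≤ f S + τ * B) := by
  classical
  have key := foldl_induction hL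
    (g := fun s j => (if s.2 = false ∧ weight b s.1 < B then do
      let d ← askMarginal (valueOracle f) j s.1
      pure (if τ * b j ≤ d then
          if b j + weight b s.1 ≤ B then (insert j s.1, false)
          else (finalAdd π b B ε s.1 j, true)
        else s)
      else pure s : Counted (Finset (Fin n) × Bool)).val)
    -- Once the flag is set, elements may have been discarded and gains no longer describe the set;
    -- only its value bound is kept.
    (fun D s => D ⊆ L.toFinset ∧ weight b s.1 ≤ B ∧
      (s.2 = true → (1 - ε) * (τ * B) ≤ f s.1) ∧
      (s.2 = false → s.1 ⊆ D ∧ (∀ e ∈ s.1, τ * b e ≤ gain π f s.1 e) ∧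
        (weight b s.1 < B → ∀ e ∈ D, e ∉ s.1 → gain π f s.1 e ≤ τ * b e)))
    (s := (∅, false)) (by simp [weight, hB.le]) (by
      rintro D ⟨S, flag⟩ j hjL hj ⟨hDL, hw, htrue, hfalse⟩
      have hDL' : insert j D ⊆ L.toFinset :=
        Finset.insert_subset (List.mem_toFinset.mpr hjL) hDL
      dsimp only at hw htrue hfalse ⊢
      by_cases hc : flag = false ∧ weight b S < B
      · rw [if_pos hc]
        obtain ⟨rfl, hwB⟩ := hc
        obtain ⟨hSD, hin, hout⟩ := hfalse rfl
        have hjS : ∀ a ∈ S, π.symm a < π.symm j := fun a ha => hj a (hSD ha)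
        have hjS' : j ∉ S := fun h => lt_irrefl _ (hjS j h)
        simp only [Counted.bind_val, Counted.pure_val]
        have hin' : τ * b j ≤ f (insert j S) - f S →
            ∀ e ∈ insert j S, τ * b e ≤ gain π f (insert j S) e := by
          intro hd e he
          rcases Finset.mem_insert.mp he with rfl | he
          · rwa [gain_insert_self hjS]
          · rw [gain_insert_of_le (hjS e he).le]
            exact hin e he
        by_cases hd : τ * b j ≤ (askMarginal (valueOracle f) j S).val
        · rw [if_pos hd]
          rw [askMarginal_val] at hd
          split_ifs with hfit
          · refine ⟨hDL', by rwa [weight_insert hjS'], by simp, fun _ => ?_⟩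
            refine ⟨Finset.insert_subset_insert _ hSD, hin' hd, fun _ e he heS => ?_⟩
            rw [Finset.mem_insert, not_or] at heS
            have heD := (Finset.mem_insert.mp he).resolve_left heS.1
            rw [gain_insert_of_le (hj e heD).le]
            exact hout hwB e heD heS.2
          · obtain ⟨h₁, h₂, h₃⟩ := finalAdd_spec (π := π) hb hε hB hX hw
              (fun e he => hlight e (List.mem_toFinset.mp
                (hDL' (Finset.insert_subset_insert _ hSD he)))) hjS' (not_le.mp hfit)
            refine ⟨hDL', h₂, fun _ => ?_, by simp⟩
            -- The survivors are counted with their gains in S + j, each at least τ times the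
            -- weight.
            have h₄ := mul_weight_le hf h₁ fun e he => hin' hd e (h₁ he)
            have h₅ := mul_le_mul_of_nonneg_left h₃ hτ
            dsimp only
            linarith
        · rw [if_neg hd]
          rw [askMarginal_val] at hd
          refine ⟨hDL', hw, by simp, fun _ => ?_⟩
          refine ⟨hSD.trans (Finset.subset_insert _ _), hin, fun h e he heS => ?_⟩
          rcases Finset.mem_insert.mp he with rfl | he
          · rw [gain_eq hjS]
            exact (not_le.mp hd).le
          · exact hout h e he heS
      · rw [if_neg hc]
        refine ⟨hDL', hw, htrue, fun h => ?_⟩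
        obtain ⟨hSD, hin, hout⟩ := hfalse h
        exact ⟨hSD.trans (Finset.subset_insert _ _), hin, fun h' => absurd ⟨h, h'⟩ hc⟩)
  simp only [budgetThresholdAdd, Counted.bind_val, Counted.pure_val, Counted.foldlM_val]
  obtain ⟨-, hw, htrue, hfalse⟩ := key
  refine ⟨hw, ?_⟩
  generalize L.foldl _ ((∅, false) : Finset (Fin n) × Bool) = s at hw htrue hfalse ⊢
  cases hflag : s.2 with
  | true => exact .inl (htrue hflag)
  | false =>
    obtain ⟨-, hin, hout⟩ := hfalse hflag
    rcases hw.eq_or_lt with h | h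
    · left
      have h₁ := mul_weight_le hf subset_rfl hin
      rw [h] at h₁
      have := mul_nonneg hε.le (mul_nonneg hτ hB.le)
      linarith
    · right
      intro T hTL hT
      refine (hf.le_add_sum_gain s.1 T).trans (add_le_add_right ?_ _)
      calc ∑ e ∈ T \ s.1, gain π f s.1 e ≤ ∑ e ∈ T \ s.1, τ * b e :=
            Finset.sum_le_sum fun e he => hout h e
              (List.mem_toFinset.mpr (hTL e (Finset.mem_sdiff.mp he).1)) (Finset.mem_sdiff.mp he).2
        _ = τ * weight b (T \ s.1) := by rw [weight, Finset.mul_sum]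
        _ ≤ τ * B := mul_le_mul_of_nonneg_left
            ((weight_mono hb Finset.sdiff_subset).trans hT) hτ

theorem budgetThresholdAdd_cost_le (L : List (Fin n)) (τ : ℝ) :
    (budgetThresholdAdd (valueOracle f) π b B ε L τ).cost ≤ L.length * 2 := by
  classical
  simp only [budgetThresholdAdd, Counted.bind_cost, Counted.pure_cost, add_zero]
  refine Counted.foldlM_cost_le (fun _ => True) (fun _ _ _ => trivial) (c := 2)
    (fun s i _ => ?_) _ trivial
  split_ifs <;> simp

theorem pairwise_filteredList (X : Finset (Fin n)) :
    (filteredList π b B ε X).Pairwise fun a b => π.symm a < π.symm b :=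
  (pairwise_orderedList π).filter _

theorem mem_filteredList {X : Finset (Fin n)} {e : Fin n} :
    e ∈ filteredList π b B ε X ↔ e ∈ X ∨ ((∀ i ∈ X, b e ≤ b i) ∧ b e < ε * B) := by
  simp [filteredList]

theorem length_filteredList_le (X : Finset (Fin n)) :
    (filteredList π b B ε X).length ≤ n :=
  (List.length_filter_le _ _).trans_eq (length_orderedList π)

/-- The candidate that `budgetAlg` computes from the guess `X`. -/
noncomputable def budgetCandidate (q : Finset (Fin n) → Counted ℝ) (π : Equiv.Perm (Fin n))
    (b : Fin n → ℝ) (B ε : ℝ) (X : Finset (Fin n)) : Counted (Finset (Fin n)) := do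
  let L := filteredList π b B ε X
  let M ← maxSingleton q L
  let sets ← (List.range (gridSize ε L.length)).mapM
    fun i => budgetThresholdAdd q π b B ε L ((1 + ε) ^ i * (M / B))
  bestOf q (X :: sets)

open Classical in
/-- The guesses for the heaviest elements of an optimal set. -/
noncomputable def budgetGuesses (b : Fin n → ℝ) (B ε : ℝ) : Finset (Finset (Fin n)) :=
  Finset.univ.filter fun X : Finset (Fin n) => weight b X ≤ B ∧ (X.card : ℝ) ≤ 1 / ε

theorem mem_budgetGuesses {X : Finset (Fin n)} :
    X ∈ budgetGuesses b B ε ↔ weight b X ≤ B ∧ (X.card : ℝ) ≤ 1 / ε := by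
  simp [budgetGuesses]

theorem budgetAlg_eq (q : Finset (Fin n) → Counted ℝ) : budgetAlg q π b B ε =
    (budgetGuesses b B ε).toList.mapM (budgetCandidate q π b B ε) >>= bestOf q := rfl

theorem budgetCandidate_spec (hf : IsSubmodularOrderFunction π f) (hb : ∀ i, 0 ≤ b i)
    (hε : 0 < ε) (hB : 0 < B) {X : Finset (Fin n)} (hX : weight b X ≤ B) :
    let L := filteredList π b B ε X
    let M := (maxSingleton (valueOracle f) L).val
    let S := (budgetCandidate (valueOracle f) π b B ε X).val
    weight b S ≤ B ∧ f X ≤ f S ∧ ∀ i < gridSize ε L.length,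
      (1 - ε) * ((1 + ε) ^ i * M) ≤ f S ∨ ∀ T : Finset (Fin n), (∀ e ∈ T, e ∈ L) →
        weight b T ≤ B → f T ≤ f S + (1 + ε) ^ i * M := by
  intro L M S
  obtain ⟨hM0, -, -⟩ := maxSingleton_spec f L
  have hlight : ∀ e ∈ L, e ∉ X → b e < ε * B := fun e he heX =>
    ((mem_filteredList.mp he).resolve_left heX).2
  have hadd := fun i : ℕ => budgetThresholdAdd_spec hf hb hε hB hX (pairwise_filteredList X) hlight
    (τ := (1 + ε) ^ i * (M / B)) (mul_nonneg (pow_nonneg (by linarith) i) (div_nonneg hM0 hB.le))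
  have hS : S = (bestOf (valueOracle f) (X :: (List.range (gridSize ε L.length)).map fun i =>
      (budgetThresholdAdd (valueOracle f) π b B ε L ((1 + ε) ^ i * (M / B))).val)).val := by
    simp only [S, budgetCandidate, Counted.bind_val, Counted.mapM_val]
    rfl
  obtain ⟨hmem, hbest⟩ := bestOf_spec f (List.cons_ne_nil X
    ((List.range (gridSize ε L.length)).map fun i =>
      (budgetThresholdAdd (valueOracle f) π b B ε L ((1 + ε) ^ i * (M / B))).val))
  rw [← hS] at hmem hbest
  refine ⟨?_, hbest X List.mem_cons_self, fun i hi => ?_⟩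
  · rcases List.mem_cons.mp hmem with h | h
    · rwa [h]
    · obtain ⟨i, -, hi⟩ := List.mem_map.mp h
      rw [← hi]
      exact (hadd i).1
  · have hle := hbest _ (List.mem_cons_of_mem X (List.mem_map.mpr ⟨i, List.mem_range.mpr hi, rfl⟩))
    have hmul : (1 + ε) ^ i * (M / B) * B = (1 + ε) ^ i * M := by field_simp
    have h := (hadd i).2
    rw [hmul] at h
    rcases h with h | h
    · exact .inl (h.trans hle)
    · exact .inr fun T hTL hT => (h T hTL hT).trans (add_le_add_left hle _)

/-- The heaviest elements of a set, `q` in number. -/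
theorem exists_heaviest (b : Fin n → ℝ) (T : Finset (Fin n)) {q : ℕ} (hq : q ≤ T.card) :
    ∃ X ⊆ T, X.card = q ∧ ∀ e ∈ T, e ∉ X → ∀ i ∈ X, b e ≤ b i := by
  induction q with
  | zero => exact ⟨∅, by simp⟩
  | succ q ih =>
    obtain ⟨X, hXT, hcard, hX⟩ := ih (by omega)
    have hne : (T \ X).Nonempty := by
      rw [← Finset.card_pos, Finset.card_sdiff_of_subset hXT]
      omega
    obtain ⟨a, ha, hmax⟩ := Finset.exists_max_image (T \ X) b hne
    obtain ⟨haT, haX⟩ := Finset.mem_sdiff.mp ha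
    refine ⟨insert a X, Finset.insert_subset haT hXT, ?_, fun e he heX i hi => ?_⟩
    · rw [Finset.card_insert_of_notMem haX, hcard]
    · rw [Finset.mem_insert, not_or] at heX
      rcases Finset.mem_insert.mp hi with rfl | hi
      · exact hmax e (Finset.mem_sdiff.mpr ⟨he, heX.2⟩)
      · exact hX e he heX.2 i hi

/-- Every feasible set is contained in the filtered ground set of some guess, unless it is itself
a guess. -/
theorem exists_guess (hb : ∀ i, 0 ≤ b i) (hε : 0 < ε) (hB : 0 < B)
    {T : Finset (Fin n)} (hT : weight b T ≤ B) (hcard : 1 / ε < T.card) :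
    ∃ X ∈ budgetGuesses b B ε, ∀ e ∈ T, e ∈ filteredList π b B ε X := by
  have hpos : 0 ≤ 1 / ε := by positivity
  have hq : ⌊1 / ε⌋₊ ≤ T.card := by
    exact_mod_cast ((Nat.floor_le hpos).trans hcard.le)
  obtain ⟨X, hXT, hXcard, hX⟩ := exists_heaviest b T hq
  refine ⟨X, mem_budgetGuesses.mpr ⟨(weight_mono hb hXT).trans hT, ?_⟩, fun e he => ?_⟩
  · rw [hXcard]
    exact Nat.floor_le hpos
  · rw [mem_filteredList]
    by_cases heX : e ∈ X
    · exact .inl heX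
    · refine .inr ⟨hX e he heX, ?_⟩
      -- Here `X` holds ⌊1/ε⌋ elements at least as heavy as `e`, so (⌊1/ε⌋ + 1) b_e ≤ B, and ⌊1/ε⌋ +
      -- 1 > 1/ε.
      have h₁ : weight b (insert e X) ≤ B :=
        (weight_mono hb (Finset.insert_subset he hXT)).trans hT
      have h₂ : X.card • b e ≤ weight b X := Finset.card_nsmul_le_sum _ _ _ (hX e he heX)
      rw [weight_insert heX] at h₁
      rw [nsmul_eq_mul, hXcard] at h₂
      have h₃ := Nat.lt_floor_add_one (1 / ε)
      rw [div_lt_iff₀ hε] at h₃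
      rcases (hb e).eq_or_lt with h0 | h0
      · rw [← h0]
        positivity
      · nlinarith

theorem budgetAlg_isApproxMax (hf : IsSubmodularOrderFunction π f) (hb : ∀ i, 0 ≤ b i)
    (hB : 0 < B) (hε : 0 < ε) (hε1 : ε < 1 / 2) :
    IsApproxMax (1 / 2 - ε) (fun S => weight b S ≤ B) f
      (budgetAlg (valueOracle f) π b B ε).val := by
  have hone : 1 < 1 / ε := by rw [lt_div_iff₀ hε]; linarith
  rw [budgetAlg_eq, Counted.bind_val, Counted.mapM_val]
  set C := (budgetGuesses b B ε).toList.map fun X =>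
    (budgetCandidate (valueOracle f) π b B ε X).val with hC
  have hempty : ∅ ∈ budgetGuesses b B ε :=
    mem_budgetGuesses.mpr ⟨by simp [weight, hB.le], by simp [hε.le]⟩
  have hmemC : ∀ X ∈ budgetGuesses b B ε, (budgetCandidate (valueOracle f) π b B ε X).val ∈ C :=
    fun X hX => List.mem_map.mpr ⟨X, Finset.mem_toList.mpr hX, rfl⟩
  obtain ⟨hmem, hbest⟩ := bestOf_spec f (List.ne_nil_of_mem (hmemC ∅ hempty))
  constructor
  · obtain ⟨X, hX, h⟩ := List.mem_map.mp hmem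
    rw [← h]
    exact (budgetCandidate_spec hf hb hε hB
      (mem_budgetGuesses.mp (Finset.mem_toList.mp hX)).1).1
  intro T hT
  set V := f (bestOf (valueOracle f) C).val
  have hV0 : 0 ≤ V := hf.nonneg _
  have hT0 := hf.nonneg T
  have hguess : ∀ X ∈ budgetGuesses b B ε, f X ≤ V := fun X hX =>
    (budgetCandidate_spec hf hb hε hB (mem_budgetGuesses.mp hX).1).2.1.trans
      (hbest _ (hmemC X hX))
  have hhalf : f T ≤ 2 * V → (1 / 2 - ε) * f T ≤ V := by
    intro h
    nlinarith
  rcases le_or_gt (T.card : ℝ) (1 / ε) with hcard | hcard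
  · have := hguess T (mem_budgetGuesses.mpr ⟨hT, hcard⟩)
    exact hhalf (by linarith)
  obtain ⟨X, hXg, hTX⟩ := exists_guess (π := π) hb hε hB hT hcard
  have hXB := (mem_budgetGuesses.mp hXg).1
  obtain ⟨-, -, hgrid⟩ := budgetCandidate_spec hf hb hε hB hXB
  have hS := hbest _ (hmemC X hXg)
  set L := filteredList π b B ε X with hL
  obtain ⟨hM0, hM, hMe⟩ := maxSingleton_spec f L
  set M := (maxSingleton (valueOracle f) L).val with hMdef
  set S := (budgetCandidate (valueOracle f) π b B ε X).val
  have hTL : T.card ≤ L.length := by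
    refine (Finset.card_le_card (t := L.toFinset) fun e he => ?_).trans (List.toFinset_card_le L)
    exact List.mem_toFinset.mpr (hTX e he)
  have hTM : f T ≤ L.length * M := (hf.le_card_mul fun e he => hM e (hTX e he)).trans
    (mul_le_mul_of_nonneg_right (by exact_mod_cast hTL) hM0)
  -- Every singleton from the filtered list is itself a guess, since 1/ε > 1; this settles optima of
  -- at most 2 M, below the grid.
  have hMV : M ≤ V := by
    rcases hMe with h | ⟨e, he, h⟩
    · rwa [h]
    · rw [← h]
      refine hguess {e} (mem_budgetGuesses.mpr ⟨?_, by simpa using hone.le⟩)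
      rw [weight, Finset.sum_singleton]
      rcases mem_filteredList.mp he with h | h
      · exact (le_weight hb h).trans hXB
      · nlinarith [h.2]
  rcases le_or_gt (f T) (2 * M) with hsmall | hbig
  · exact hhalf (by linarith)
  have hMpos : 0 < M := by
    refine hM0.lt_of_ne' fun h => ?_
    rw [h, mul_zero] at hTM hbig
    linarith
  have hLpos : 1 ≤ L.length := by
    rw [Nat.one_le_iff_ne_zero]
    intro h
    rw [h, Nat.cast_zero, zero_mul] at hTM
    linarith
  obtain ⟨i, hi₁, hi₂⟩ := exists_nat_pow_near (x := f T / (2 * M)) (y := 1 + ε)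
    (by rw [one_le_div (by linarith)]; exact hbig.le) (by linarith)
  rw [le_div_iff₀ (by linarith)] at hi₁
  rw [div_lt_iff₀ (by linarith), pow_succ] at hi₂
  have hiJ : i < gridSize ε L.length := by
    by_contra hcon
    have h₁ := (le_pow_gridSize hε hLpos).trans
      (pow_le_pow_right₀ (by linarith : 1 ≤ 1 + ε) (not_lt.mp hcon))
    nlinarith
  have hx : 0 ≤ (1 + ε) ^ i * M := by positivity
  rcases hgrid i hiJ with h | h
  · have hV := h.trans hS
    set x := (1 + ε) ^ i * M
    have h₁ : f T < 2 * ((1 + ε) * x) := by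
      rw [show 2 * ((1 + ε) * x) = (1 + ε) ^ i * (1 + ε) * (2 * M) by ring]
      exact hi₂
    -- Both losses together fit: (1 - 2ε)(1 + ε) ≤ 1 - ε.
    have h₂ : (1 / 2 - ε) * f T ≤ (1 / 2 - ε) * (2 * ((1 + ε) * x)) :=
      mul_le_mul_of_nonneg_left h₁.le (by linarith)
    nlinarith [mul_nonneg hx (mul_self_nonneg ε)]
  · have := h T hTX hT
    exact hhalf (by linarith)

/-- Bounding C(n, i) by n^q / i! makes the sum at most e n^q, with no extra factor q. -/
theorem card_budgetGuesses_le (hn : 0 < n) (hε : 0 < ε) :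
    ((budgetGuesses b B ε : Finset (Finset (Fin n))).card : ℝ) ≤ 3 * (n : ℝ) ^ (1 / ε) := by
  have hn1 : (1 : ℝ) ≤ n := by exact_mod_cast hn
  set q := ⌊1 / ε⌋₊
  have hsub : budgetGuesses b B ε ⊆
      (Finset.range (q + 1)).biUnion fun i => Finset.powersetCard i (Finset.univ : Finset (Fin n)) := by
    intro X hX
    rw [Finset.mem_biUnion]
    refine ⟨X.card, ?_, Finset.mem_powersetCard.mpr ⟨Finset.subset_univ _, rfl⟩⟩
    rw [Finset.mem_range, Nat.lt_succ_iff]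
    exact Nat.le_floor (mem_budgetGuesses.mp hX).2
  have hcard : (budgetGuesses b B ε : Finset (Finset (Fin n))).card ≤
      ∑ i ∈ Finset.range (q + 1), n.choose i := by
    refine (Finset.card_le_card hsub).trans (Finset.card_biUnion_le.trans_eq ?_)
    exact Finset.sum_congr rfl fun i _ => by rw [Finset.card_powersetCard, Finset.card_fin]
  calc ((budgetGuesses b B ε : Finset (Finset (Fin n))).card : ℝ)
      ≤ ∑ i ∈ Finset.range (q + 1), (n.choose i : ℝ) := by exact_mod_cast hcard
    _ ≤ ∑ i ∈ Finset.range (q + 1), (n : ℝ) ^ q * (1 ^ i / (i.factorial : ℝ)) := by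
      refine Finset.sum_le_sum fun i hi => (Nat.choose_le_pow_div i n).trans ?_
      rw [one_pow, mul_one_div]
      have : i ≤ q := Nat.lt_succ_iff.mp (Finset.mem_range.mp hi)
      gcongr
    _ = (n : ℝ) ^ q * ∑ i ∈ Finset.range (q + 1), (1 : ℝ) ^ i / (i.factorial : ℝ) := by
      rw [Finset.mul_sum]
    _ ≤ (n : ℝ) ^ q * 3 := by
      refine mul_le_mul_of_nonneg_left ?_ (by positivity)
      exact (Real.sum_le_exp_of_nonneg zero_le_one _).trans
        (Real.exp_one_lt_d9.le.trans (by norm_num))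
    _ ≤ 3 * (n : ℝ) ^ (1 / ε) := by
      rw [mul_comm, ← Real.rpow_natCast]
      refine mul_le_mul_of_nonneg_left (Real.rpow_le_rpow_of_exponent_le hn1 ?_) (by norm_num)
      exact Nat.floor_le (by positivity)

theorem budgetCandidate_cost_le (hn : 0 < n) (hε : 0 < ε) (X : Finset (Fin n)) :
    (budgetCandidate (valueOracle f) π b B ε X).cost ≤ 5 * (n * max 1 (gridSize ε n)) := by
  simp only [budgetCandidate, Counted.bind_cost, Counted.mapM_val]
  set L := filteredList π b B ε X
  set J := max 1 (gridSize ε n)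
  set M := (maxSingleton (valueOracle f) L).val
  have hLn : L.length ≤ n := length_filteredList_le X
  have hJ : gridSize ε L.length ≤ J := (gridSize_mono hε hLn).trans (le_max_right _ _)
  have hJ1 : 1 ≤ J := le_max_left _ _
  have h₁ := maxSingleton_cost_le (f := f) L
  have h₂ := Counted.mapM_cost_le (g := fun i =>
    budgetThresholdAdd (valueOracle f) π b B ε L ((1 + ε) ^ i * (M / B)))
    (fun i => budgetThresholdAdd_cost_le L _) (List.range (gridSize ε L.length))
  have h₃ := bestOf_cost_le (f := f) (X :: (List.range (gridSize ε L.length)).map fun i =>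
    (budgetThresholdAdd (valueOracle f) π b B ε L ((1 + ε) ^ i * (M / B))).val)
  rw [List.length_range] at h₂
  rw [List.length_cons, List.length_map, List.length_range] at h₃
  have h₄ : n * 1 ≤ n * J := Nat.mul_le_mul_left n hJ1
  have h₅ : 1 * J ≤ n * J := Nat.mul_le_mul_right J hn
  have h₆ : gridSize ε L.length * (L.length * 2) ≤ J * (n * 2) := by gcongr
  have h₇ : J * (n * 2) = 2 * (n * J) := by ring
  omega

theorem budgetAlg_cost_le (hn : 0 < n) (hε : 0 < ε) (hε1 : ε < 1) :
    ((budgetAlg (valueOracle f) π b B ε).cost : ℝ) ≤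
      72 * (1 / ε * (n : ℝ) ^ (1 + 1 / ε) * Real.log ((n : ℝ) + 1)) := by
  have hn0 : (0 : ℝ) < n := by exact_mod_cast hn
  have hJ := max_one_gridSize_le hε hε1 hn
  have hG := card_budgetGuesses_le (b := b) (B := B) hn hε
  set J := max 1 (gridSize ε n)
  set G := (budgetGuesses b B ε : Finset (Finset (Fin n))).card
  have hcost : (budgetAlg (valueOracle f) π b B ε).cost ≤ 6 * (G * (n * J)) := by
    rw [budgetAlg_eq, Counted.bind_cost, Counted.mapM_val]
    have h₁ := Counted.mapM_cost_le
      (fun X => budgetCandidate_cost_le (f := f) (π := π) (b := b) (B := B) hn hε X)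
      (budgetGuesses b B ε).toList
    have h₂ := bestOf_cost_le (f := f) ((budgetGuesses b B ε).toList.map fun X =>
      (budgetCandidate (valueOracle f) π b B ε X).val)
    rw [Finset.length_toList] at h₁
    rw [List.length_map, Finset.length_toList] at h₂
    have h₃ : G * 1 ≤ G * (n * J) :=
      Nat.mul_le_mul_left G (Nat.mul_pos hn (lt_max_of_lt_left one_pos))
    have h₄ : G * (5 * (n * J)) = 5 * (G * (n * J)) := by ring
    change _ ≤ G * (5 * (n * J)) at h₁
    change _ ≤ G at h₂
    omega
  calc ((budgetAlg (valueOracle f) π b B ε).cost : ℝ) ≤ 6 * (G * (n * J)) := by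
        exact_mod_cast hcost
    _ ≤ 6 * ((3 * (n : ℝ) ^ (1 / ε)) * (n * (4 * (Real.log ((n : ℝ) + 1) / ε)))) := by gcongr
    _ = _ := by
      rw [Real.rpow_add hn0, Real.rpow_one]
      ring

end Budget

/-! ### Matroid constraint -/

/-- If `w` has at most as many values above each threshold as `v`, then its sum is at most that
of `v`. -/
theorem sum_le_sum_of_card_filter_le {ι κ : Type*} [DecidableEq ι] [DecidableEq κ] {s : Finset ι}
    {t : Finset κ} {w : ι → ℝ} {v : κ → ℝ} (hv : ∀ k ∈ t, 0 ≤ v k)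
    (h : ∀ θ : ℝ, (s.filter fun i => θ ≤ w i).card ≤ (t.filter fun k => θ ≤ v k).card) :
    ∑ i ∈ s, w i ≤ ∑ k ∈ t, v k := by
  induction s using Finset.induction_on_max_value w generalizing t with
  | empty => simpa using Finset.sum_nonneg hv
  | insert a s ha hmax ih =>
    have hcard : ∀ θ ≤ w a, ((insert a s).filter fun i => θ ≤ w i).card =
        (s.filter fun i => θ ≤ w i).card + 1 := fun θ hθ => by
      rw [Finset.filter_insert, if_pos hθ, Finset.card_insert_of_notMem]
      exact fun h => ha (Finset.mem_filter.mp h).1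
    have hne : (t.filter fun k => w a ≤ v k).Nonempty := by
      rw [← Finset.card_pos]
      exact lt_of_lt_of_le (by rw [hcard _ le_rfl]; omega) (h (w a))
    -- Match the largest `w a` with some `v k` above it and delete both: counts at thresholds up to
    -- `w a` drop by one on each side, and above `w a` none is left on the left.
    obtain ⟨k, hk⟩ := hne
    obtain ⟨hkt, hkv⟩ := Finset.mem_filter.mp hk
    rw [Finset.sum_insert ha, ← Finset.add_sum_erase t v hkt]
    refine add_le_add hkv (ih (fun i hi => hv i (Finset.mem_of_mem_erase hi)) fun θ => ?_)
    rcases le_or_gt θ (w a) with hθ | hθ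
    · have h₁ := h θ
      rw [hcard θ hθ] at h₁
      have h₂ : ((t.erase k).filter fun k => θ ≤ v k).card + 1 =
          (t.filter fun k => θ ≤ v k).card := by
        rw [Finset.filter_erase]
        exact Finset.card_erase_add_one (Finset.mem_filter.mpr ⟨hkt, hθ.trans hkv⟩)
      omega
    · rw [Finset.filter_false_of_mem fun i hi => not_le.mpr ((hmax i hi).trans_lt hθ)]
      simp

/-! ### Circuits, exchanges and closure in a matroid -/

section Exchange

variable {α : Type*} {M : Matroid α} {I : Set α} {j : α}

/-- The elements of `I` that can be exchanged for `j` are those of the circuit in `I + j`. -/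
theorem isCircuit_insert_exchangeable (hI : M.Indep I) (hj : j ∈ M.E) (hjI : j ∉ I)
    (hdep : ¬M.Indep (insert j I)) :
    M.IsCircuit (insert j {i | i ∈ I ∧ M.Indep (insert j I \ {i})}) := by
  have hcl : j ∈ M.closure I := (hI.mem_closure_iff_of_notMem hjI).mpr
    ((Matroid.not_indep_iff (Set.insert_subset hj hI.subset_ground)).mp hdep)
  convert hI.fundCircuit_isCircuit hcl hjI using 1
  ext i
  rw [hI.mem_fundCircuit_iff hcl hjI, Set.mem_insert_iff]
  constructor
  · rintro (rfl | ⟨-, h⟩)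
    · rwa [Set.insert_sdiff_of_mem _ (Set.mem_singleton _), Set.sdiff_singleton_eq_self hjI]
    · exact h
  · intro h
    by_contra! hcon
    have hiI : i ∉ I := fun hiI => hcon.2 ⟨hiI, h⟩
    rw [Set.sdiff_singleton_eq_self fun hi => (Set.mem_insert_iff.mp hi).elim hcon.1 hiI] at h
    exact hdep h

theorem mem_closure_exchangeable (hI : M.Indep I) (hj : j ∈ M.E) (hjI : j ∉ I)
    (hdep : ¬M.Indep (insert j I)) :
    j ∈ M.closure {i | i ∈ I ∧ M.Indep (insert j I \ {i})} := by
  have := (isCircuit_insert_exchangeable hI hj hjI hdep).mem_closure_sdiff_singleton_of_mem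
    (Set.mem_insert j _)
  rwa [Set.insert_sdiff_of_mem _ (Set.mem_singleton _), Set.sdiff_singleton_eq_self fun h => hjI h.1] at this

/-- An element of a circuit is spanned by the others. So after swapping `i` for `j`, whatever `i`
helped to span remains spanned. -/
theorem mem_closure_of_exchangeable (hI : M.Indep I) (hj : j ∈ M.E) (hjI : j ∉ I)
    (hdep : ¬M.Indep (insert j I)) {i : α} (hi : i ∈ I) (hij : M.Indep (insert j I \ {i}))
    {U : Set α} (hjU : j ∈ U) (hU : ∀ k ∈ I, M.Indep (insert j I \ {k}) → k ≠ i → k ∈ U) :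
    i ∈ M.closure U := by
  have := (isCircuit_insert_exchangeable hI hj hjI hdep).mem_closure_sdiff_singleton_of_mem
    (Set.mem_insert_of_mem j ⟨hi, hij⟩)
  refine M.closure_subset_closure ?_ this
  rintro k ⟨rfl | hk, hki⟩
  · exact hjU
  · exact hU k hk.1 hk.2 hki

theorem ncard_le_of_subset_closure {S U : Set α} [Finite α] (hS : M.Indep S)
    (h : S ⊆ M.closure U) : S.ncard ≤ U.ncard := by
  have h₁ := (hS.encard_le_eRk_of_subset h).trans
    ((M.eRk_closure_eq U).le.trans (M.eRk_le_encard U))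
  rw [← S.toFinite.cast_ncard_eq, ← U.toFinite.cast_ncard_eq] at h₁
  exact_mod_cast h₁

end Exchange

/-! ### Directed local search: one step, its invariants and the approximation ratio -/

section SwapStep

variable {n : ℕ} {π : Equiv.Perm (Fin n)} {f : Finset (Fin n) → ℝ} {M : Matroid (Fin n)}
  {s : SwapState n} {j : Fin n}

theorem swapStep_of_indep (h : M.Indep (insert j s.S : Finset (Fin n))) :
    swapStep (valueOracle f) π M s j =
      ⟨⟨insert j s.S, s.R, Function.update s.v j (f (insert j (s.S ∪ s.R)) - f (s.S ∪ s.R))⟩, 3⟩ := by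
  rw [swapStep, if_pos h]
  rfl

/-- The effect of `swapStep` on a dependent set `S + j`. -/
theorem swapStep_of_not_indep (h : ¬M.Indep (insert j s.S : Finset (Fin n))) :
    (swapStep (valueOracle f) π M s j).cost ≤ s.S.card + 3 ∧
    (((swapStep (valueOracle f) π M s j).val = s ∧
        ∀ i ∈ s.S, ¬M.Indep ((insert j s.S).erase i : Finset (Fin n))) ∨
      ∃ i ∈ s.S, M.Indep ((insert j s.S).erase i : Finset (Fin n)) ∧
        (∀ k ∈ s.S, M.Indep ((insert j s.S).erase k : Finset (Fin n)) → s.v i ≤ s.v k) ∧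
        ((f (insert j (s.S ∪ s.R)) - f (s.S ∪ s.R) ≤ s.v i ∧
            (swapStep (valueOracle f) π M s j).val = s) ∨
          (s.v i < f (insert j (s.S ∪ s.R)) - f (s.S ∪ s.R) ∧
            (swapStep (valueOracle f) π M s j).val = ⟨(insert j s.S).erase i, insert i s.R,
              Function.update s.v j (s.v i + (f (insert j (s.S ∪ s.R)) - f (s.S ∪ s.R)))⟩))) := by
  classical
  rw [swapStep, if_neg h]
  simp only [Counted.bind_val, Counted.bind_cost, Counted.charge_cost]
  split
  next hnone =>
    refine ⟨by simp only [Counted.pure_cost]; omega, .inl ⟨rfl, fun i hi hind => ?_⟩⟩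
    rw [List.argmin_eq_none, List.filter_eq_nil_iff] at hnone
    exact hnone i (mem_orderedList π i) (by simpa using ⟨hi, by simpa using hind⟩)
  next i hsome =>
    have hmem := List.mem_filter.mp (List.argmin_mem hsome)
    have hi : i ∈ s.S ∧ M.Indep ((insert j s.S).erase i : Finset (Fin n)) := by
      simpa using hmem.2
    refine ⟨by simp only [Counted.bind_cost, Counted.pure_cost, askMarginal_cost]; omega,
      .inr ⟨i, hi.1, hi.2, fun k hk hind => ?_, ?_⟩⟩
    · refine List.le_of_mem_argmin (List.mem_filter.mpr ⟨mem_orderedList π k, ?_⟩) hsome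
      simpa using ⟨hk, by simpa using hind⟩
    · simp only [Counted.bind_val, Counted.pure_val]
      split_ifs with hd <;> rw [askMarginal_val] at hd
      · exact .inr ⟨hd, rfl⟩
      · exact .inl ⟨not_lt.mp hd, rfl⟩

theorem swapStep_indep (hs : M.Indep (s.S : Set (Fin n))) :
    M.Indep ((swapStep (valueOracle f) π M s j).val.S : Set (Fin n)) := by
  by_cases h : M.Indep (insert j s.S : Finset (Fin n))
  · rw [swapStep_of_indep h]
    exact h
  · obtain ⟨-, ⟨h', -⟩ | ⟨i, -, hi, -, ⟨-, h'⟩ | ⟨-, h'⟩⟩⟩ := swapStep_of_not_indep (f := f) (π := π) h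
    · rwa [h']
    · rwa [h']
    · rwa [h']

/-- Invariants of the directed local search after the elements of `D` have been parsed. -/
structure SwapInvariant (π : Equiv.Perm (Fin n)) (f : Finset (Fin n) → ℝ) (M : Matroid (Fin n))
    (D : Finset (Fin n)) (s : SwapState n) : Prop where
  subset : s.S ∪ s.R ⊆ D
  indep : M.Indep (s.S : Set (Fin n))
  sum_v : ∑ i ∈ s.S, s.v i = f (s.S ∪ s.R)
  v_nonneg : ∀ i ∈ s.S, 0 ≤ s.v i
  v_le : ∀ i ∈ s.S, s.v i ≤ 2 * gain π f (s.S ∪ s.R) i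
  mem_closure : ∀ e ∈ D, e ∉ s.S ∪ s.R →
    e ∈ M.closure {i | i ∈ s.S ∧ gain π f (s.S ∪ s.R) e ≤ s.v i}

/-- The delicate clause is `mem_closure`. A newly rejected `j` is spanned by its circuit, whose
values are at least the minimum and so at least the gain of `j`. In a swap, the removed `i` is
spanned by the rest of the circuit, with values at least `v i` by minimality, and by `j`, with value
v_i + d ≥ v_i; hence old rejections stay spanned at the same threshold. -/
theorem SwapInvariant.step (hf : IsSubmodularOrderFunction π f) (hM : M.E = Set.univ)
    {D : Finset (Fin n)} (hj : ∀ a ∈ D, π.symm a < π.symm j) (h : SwapInvariant π f M D s) :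
    SwapInvariant π f M (insert j D) (swapStep (valueOracle f) π M s j).val := by
  obtain ⟨hsub, hind, hsum, hv0, hv2, hcl⟩ := h
  obtain ⟨S, R, v⟩ := s
  dsimp only at hsub hind hsum hv0 hv2 hcl
  have hjA : ∀ a ∈ S ∪ R, π.symm a < π.symm j := fun a ha => hj a (hsub ha)
  have hjA' : j ∉ S ∪ R := fun h => lt_irrefl _ (hjA j h)
  have hjS : j ∉ S := fun h => hjA' (Finset.mem_union_left _ h)
  have hne : ∀ k ∈ S, k ≠ j := fun k hk hkj => hjS (hkj ▸ hk)
  have hupd : ∀ x : ℝ, ∀ k ∈ S, Function.update v j x k = v k := fun x k hk =>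
    Function.update_of_ne (hne k hk) _ _
  have hjE : j ∈ M.E := hM ▸ Set.mem_univ j
  have hgain : ∀ e ∈ D, gain π f (insert j (S ∪ R)) e = gain π f (S ∪ R) e := fun e he =>
    gain_insert_of_le (hj e he).le
  have hSD : ∀ e ∈ S, e ∈ D := fun e he => hsub (Finset.mem_union_left _ he)
  have hgainj := gain_insert_self (f := f) hjA
  have hd0 := hf.gain_nonneg (π := π) (insert j (S ∪ R)) j
  rw [hgainj] at hd0
  have hgainj' := gain_eq (f := f) hjA
  set d := f (insert j (S ∪ R)) - f (S ∪ R) with hd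
  by_cases hcase : M.Indep (insert j S : Finset (Fin n))
  · rw [swapStep_of_indep hcase]
    have hA : insert j S ∪ R = insert j (S ∪ R) := Finset.insert_union j S R
    constructor <;> dsimp only <;> try rw [hA]
    · exact Finset.insert_subset_insert j hsub
    · exact hcase
    · rw [Finset.sum_insert hjS, Function.update_self, Finset.sum_congr rfl (hupd _), hsum]
      ring
    · intro i hi
      rcases Finset.mem_insert.mp hi with rfl | hi
      · rwa [Function.update_self]
      · rw [hupd _ i hi]
        exact hv0 i hi
    · intro i hi
      rcases Finset.mem_insert.mp hi with rfl | hi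
      · rw [Function.update_self, hgainj]
        linarith
      · rw [hupd _ i hi, hgain i (hSD i hi)]
        exact hv2 i hi
    · intro e he heA
      rw [Finset.mem_insert, not_or] at heA
      have heD := (Finset.mem_insert.mp he).resolve_left heA.1
      refine M.closure_subset_closure ?_ (hcl e heD heA.2)
      rintro k ⟨hk, hkv⟩
      exact ⟨Finset.mem_insert_of_mem hk, by rwa [hgain e heD, hupd _ k hk]⟩
  have hdep : ¬M.Indep (insert j (S : Set (Fin n))) := by
    rwa [← Finset.coe_insert]
  have hcoe : ∀ i, (((insert j S).erase i : Finset (Fin n)) : Set (Fin n)) =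
      insert j (S : Set (Fin n)) \ {i} := fun i => by
    rw [Finset.coe_erase, Finset.coe_insert]
  have hspan := mem_closure_exchangeable hind hjE hjS hdep
  have hstay : (∀ k ∈ S, M.Indep (insert j (S : Set (Fin n)) \ {k}) → d ≤ v k) →
      SwapInvariant π f M (insert j D) ⟨S, R, v⟩ := by
    intro hle
    refine ⟨hsub.trans (Finset.subset_insert _ _), hind, hsum, hv0, hv2, fun e he heA => ?_⟩
    rcases Finset.mem_insert.mp he with rfl | he
    · refine M.closure_subset_closure ?_ hspan
      rintro k ⟨hk, hkI⟩
      exact ⟨hk, by dsimp only; rw [hgainj']; exact hle k hk hkI⟩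
    · exact hcl e he heA
  obtain ⟨-, ⟨h', hnone⟩ | ⟨i, hi, hiI, hmin, ⟨hdi, h'⟩ | ⟨hdi, h'⟩⟩⟩ :=
    swapStep_of_not_indep (f := f) (π := π) (s := ⟨S, R, v⟩) hcase
  · rw [h']
    refine hstay fun k hk hkI => absurd ?_ (hnone k hk)
    rwa [hcoe]
  · rw [h']
    refine hstay fun k hk hkI => hdi.trans (hmin k hk ?_)
    rwa [hcoe]
  rw [h']
  dsimp only at hi hiI hmin hdi ⊢
  rw [← hd] at hdi ⊢
  have hA : (insert j S).erase i ∪ insert i R = insert j (S ∪ R) := by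
    ext e
    simp only [Finset.mem_union, Finset.mem_erase, Finset.mem_insert]
    by_cases hei : e = i
    · subst hei
      simp [hi]
    · simp [hei, or_assoc]
  have hS' : ∀ k ∈ (insert j S).erase i, k = j ∨ k ∈ S := fun k hk =>
    Finset.mem_insert.mp (Finset.mem_of_mem_erase hk)
  constructor <;> dsimp only <;> try rw [hA]
  · exact Finset.insert_subset_insert j hsub
  · exact hiI
  -- The new element inherits the value of the removed one, which stays in S ∪ R, so both sides grow
  -- by exactly `d`.
  · have h₁ := Finset.add_sum_erase (insert j S) (Function.update v j (v i + d))
      (Finset.mem_insert_of_mem hi)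
    rw [Finset.sum_insert hjS, Function.update_self, Finset.sum_congr rfl (hupd _), hsum,
      hupd _ i hi] at h₁
    linarith
  · intro k hk
    rcases hS' k hk with rfl | hk
    · rw [Function.update_self]
      exact add_nonneg (hv0 i hi) hd0
    · rw [hupd _ k hk]
      exact hv0 k hk
  · intro k hk
    rcases hS' k hk with rfl | hk
    -- A swap requires v_i < d, whence v_i + d ≤ 2 d; this is the source of the factor 2.
    · rw [Function.update_self, hgainj]
      linarith
    · rw [hupd _ k hk, hgain k (hSD k hk)]
      exact hv2 k hk
  · intro e he heA
    rw [Finset.mem_insert, not_or] at heA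
    have heD := (Finset.mem_insert.mp he).resolve_left heA.1
    rw [hgain e heD]
    refine M.closure_subset_closure_of_subset_closure ?_ (hcl e heD heA.2)
    set θ := gain π f (S ∪ R) e
    have hkeep : ∀ k ∈ S, k ≠ i → θ ≤ v k →
        k ∈ {k | k ∈ (insert j S).erase i ∧ θ ≤ Function.update v j (v i + d) k} :=
      fun k hk hki hθ => ⟨Finset.mem_erase.mpr ⟨hki, Finset.mem_insert_of_mem hk⟩, by
        rwa [hupd _ k hk]⟩
    rintro k ⟨hk, hθ⟩
    by_cases hki : k = i
    · subst hki
      refine mem_closure_of_exchangeable hind hjE hjS hdep hk (by rwa [← hcoe])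
        ⟨Finset.mem_erase.mpr ⟨(hne k hk).symm, Finset.mem_insert_self _ _⟩, ?_⟩ ?_
      · rw [Function.update_self]
        linarith
      · intro l hl hlI hlk
        exact hkeep l hl hlk (hθ.trans (hmin l hl (by rwa [hcoe])))
    · exact M.mem_closure_of_mem' (hkeep k hk hki hθ) (hM ▸ Set.mem_univ k)

theorem matroidAlg_val (f : Finset (Fin n) → ℝ) (π : Equiv.Perm (Fin n)) (M : Matroid (Fin n)) :
    (matroidAlg (valueOracle f) π M).val =
      ((orderedList π).foldl (fun s j => (swapStep (valueOracle f) π M s j).val)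
        ⟨∅, ∅, fun _ => 0⟩).S := by
  simp only [matroidAlg, Counted.bind_val, Counted.pure_val, Counted.foldlM_val]

theorem matroidAlg_isApproxMax (hf : IsSubmodularOrderFunction π f) (hM : M.E = Set.univ) :
    IsApproxMax (1 / 4) (fun S => M.Indep (S : Set (Fin n))) f
      (matroidAlg (valueOracle f) π M).val := by
  have key := foldl_induction (pairwise_orderedList π)
    (g := fun s j => (swapStep (valueOracle f) π M s j).val) (SwapInvariant π f M)
    (s := ⟨∅, ∅, fun _ => 0⟩)
    ⟨by simp, by simp, by simp [hf.map_empty], by simp, by simp, by simp⟩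
    (fun D s j _ hj h => h.step hf hM hj)
  rw [matroidAlg_val]
  rw [toFinset_orderedList] at key
  generalize List.foldl _ (⟨∅, ∅, fun _ => 0⟩ : SwapState n) _ = s at key
  obtain ⟨-, hind, hsum, hv0, hv2, hcl⟩ := key
  refine ⟨hind, fun T hT => ?_⟩
  set A := s.S ∪ s.R
  have h₁ := hf.le_add_sum_gain A T
  -- For each θ, the elements of T \ A with gain at least θ are independent and spanned by the
  -- elements of `S` with value at least θ.
  have h₂ : ∑ e ∈ T \ A, gain π f A e ≤ ∑ i ∈ s.S, s.v i := by
    refine sum_le_sum_of_card_filter_le hv0 fun θ => ?_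
    have := ncard_le_of_subset_closure (M := M)
      (S := ((T \ A).filter fun e => θ ≤ gain π f A e : Finset (Fin n)))
      (U := (s.S.filter fun i => θ ≤ s.v i : Finset (Fin n)))
      (hT.subset (Finset.coe_subset.mpr ((Finset.filter_subset _ _).trans Finset.sdiff_subset)))
      (by
        intro e he
        obtain ⟨heT, hθ⟩ := Finset.mem_filter.mp (Finset.mem_coe.mp he)
        refine M.closure_subset_closure ?_
          (hcl e (Finset.mem_univ e) (Finset.mem_sdiff.mp heT).2)
        rintro i ⟨hi, hiv⟩
        exact Finset.mem_coe.mpr (Finset.mem_filter.mpr ⟨hi, hθ.trans hiv⟩))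
    rwa [Set.ncard_coe_finset, Set.ncard_coe_finset] at this
  have h₃ : ∑ i ∈ s.S, s.v i ≤ 2 * f s.S := by
    refine (Finset.sum_le_sum hv2).trans ?_
    rw [← Finset.mul_sum]
    exact mul_le_mul_of_nonneg_left (hf.sum_gain_le Finset.subset_union_left) zero_le_two
  linarith

theorem matroidAlg_cost_le {d : ℕ} (hd : M.eRank = d) :
    (matroidAlg (valueOracle f) π M).cost ≤ 4 * (n * max d 1) := by
  simp only [matroidAlg, Counted.bind_cost, Counted.pure_cost, add_zero]
  -- One test of S + j, at most `d` exchange tests as `S` is independent, and two value queries; d +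
  -- 3 ≤ 4 max(d, 1).
  refine (Counted.foldlM_cost_le (c := d + 3) (fun s => M.Indep (s.S : Set (Fin n)))
    (fun s j hs => swapStep_indep hs) (fun s j hs => ?_) _ (by simp)).trans ?_
  · by_cases h : M.Indep (insert j s.S : Finset (Fin n))
    · rw [swapStep_of_indep h]
      simp
    · have h₁ := (swapStep_of_not_indep (f := f) (π := π) h).1
      have h₂ := hs.encard_le_eRank
      rw [hd, Set.encard_coe_eq_coe_finsetCard, Nat.cast_le] at h₂
      omega
  · rw [length_orderedList, mul_left_comm]
    exact Nat.mul_le_mul_left n (by omega)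

end SwapStep

end SubmodularOrder

theorem theorem7 :
    ∃ K : ℝ, ∀ (n m : ℕ), 0 < n →
      ∀ (P : SubmodularOrder.MNLMixture n m) (r : Fin n → ℝ) (π : Equiv.Perm (Fin n)),
      Antitone (fun p => r (π p)) →
      -- the objective belongs to the class of submodular order functions
      SubmodularOrder.IsSubmodularOrderFunction π (P.objective r) ∧
      -- cardinality constraint
      (∀ (k : ℕ) (ε : ℝ), 1 ≤ k → 0 < ε → ε < 1 →
        SubmodularOrder.IsApproxMax ((1 - ε) * (1 / 2)) (fun S => S.card ≤ k) (P.objective r)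
          (SubmodularOrder.cardinalityAlg
            (SubmodularOrder.valueOracle (P.objective r)) π k ε).val ∧
        ((SubmodularOrder.cardinalityAlg
            (SubmodularOrder.valueOracle (P.objective r)) π k ε).cost : ℝ)
          ≤ K * ((n : ℝ) / ε * Real.log ((k : ℝ) + 1))) ∧
      -- budget constraint
      (∀ (b : Fin n → ℝ) (B ε : ℝ), (∀ i, 0 ≤ b i) → 0 < B → 0 < ε → ε < 1 / 2 →
        SubmodularOrder.IsApproxMax (1 / 2 - ε) (fun S => SubmodularOrder.weight b S ≤ B)
          (P.objective r)
          (SubmodularOrder.budgetAlg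
            (SubmodularOrder.valueOracle (P.objective r)) π b B ε).val ∧
        ((SubmodularOrder.budgetAlg
            (SubmodularOrder.valueOracle (P.objective r)) π b B ε).cost : ℝ)
          ≤ K * (1 / ε * (n : ℝ) ^ (1 + 1 / ε) * Real.log ((n : ℝ) + 1))) ∧
      -- matroid constraint
      (∀ (M : Matroid (Fin n)) (d : ℕ), M.E = Set.univ → M.eRank = d →
        SubmodularOrder.IsApproxMax (1 / 4) (fun S => M.Indep (S : Set (Fin n))) (P.objective r)
          (SubmodularOrder.matroidAlg
            (SubmodularOrder.valueOracle (P.objective r)) π M).val ∧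
        ((SubmodularOrder.matroidAlg
            (SubmodularOrder.valueOracle (P.objective r)) π M).cost : ℝ)
          ≤ K * ((n : ℝ) * (max d 1 : ℕ))) ∧
      -- every value query can be answered in time linear in the number of types
      (∀ S : Finset (Fin n),
        (SubmodularOrder.evalObjective P r π S).val = P.objective r S ∧
        ((SubmodularOrder.evalObjective P r π S).cost : ℝ) ≤ K * ((m : ℝ) * n)) := by
  -- The budget bound dictates 72 = 6 · 3 · 4; the others need 16, 4 and 8.
  refine ⟨72, fun n m hn P r π hr => ?_⟩
  have hf := SubmodularOrder.MNLMixture.isSubmodularOrderFunction_objective (P := P) hr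
  have hn1 : (1 : ℝ) ≤ n := by exact_mod_cast hn
  refine ⟨hf, fun k ε hk hε hε1 => ⟨?_, ?_⟩, fun b B ε hb hB hε hε1 => ⟨?_, ?_⟩,
    fun M d hM hd => ⟨?_, ?_⟩, fun S => ⟨?_, ?_⟩⟩
  · exact SubmodularOrder.cardinalityAlg_isApproxMax hf hk hε hε1
  · refine (SubmodularOrder.cardinalityAlg_cost_le hn hk hε hε1).trans ?_
    refine mul_le_mul_of_nonneg_right (by norm_num) (mul_nonneg (by positivity) ?_)
    linarith [SubmodularOrder.half_le_log_add_one hk]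
  · exact SubmodularOrder.budgetAlg_isApproxMax hf hb hB hε hε1
  · exact SubmodularOrder.budgetAlg_cost_le hn hε (by linarith)
  · exact SubmodularOrder.matroidAlg_isApproxMax hf hM
  · have h : ((SubmodularOrder.matroidAlg
        (SubmodularOrder.valueOracle (P.objective r)) π M).cost : ℝ) ≤
        4 * ((n : ℝ) * (max d 1 : ℕ)) := by
      exact_mod_cast SubmodularOrder.matroidAlg_cost_le hd
    exact h.trans (mul_le_mul_of_nonneg_right (by norm_num) (by positivity))
  · exact SubmodularOrder.MNLMixture.evalObjective_val hr S
  · have h : ((SubmodularOrder.evalObjective P r π S).cost : ℝ) ≤ m * (n * 6 + 2) := by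
      exact_mod_cast SubmodularOrder.MNLMixture.evalObjective_cost_le S
    have hm : (0 : ℝ) ≤ m := m.cast_nonneg
    nlinarith
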